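/- **Theorem 2.7.** Let $X$ be a complex Banach space and let $Q$ be a bounded linear operator on $X$ with $\sigma(Q)=\{0\}$. Let $\mathbb N=\{1,2,\dots\}$, $\mathbb R_+=(0,\infty)$, $\mathbb C_+=\{s\in\mathbb C:\operatorname{Re}s>0\}$; for $A,B\subset\mathbb C$ put $AB=\{zs:z\in A,\ s\in B\}$, $-A=\{-z:z\in A\}$ and $A^{1/2}=\{z\in\mathbb C: z^2\in A\}$. Define $$\begin{aligned} \mathcal B_Q&=\{z\in\mathbb C:\ \sup_{j\in\mathbb N}\|(1+zQ)^j\|<\infty\},\\ \mathcal A_Q^k&=\{z\in\mathbb C:\ \limsup_{s\to+\infty}\|(1-szQ)^{-k}\|<\infty\}\quad(k\in\mathbb N),\\ \mathcal G_Q&=\{z\in\mathbb C:\ \limsup_{t\to+\infty}\|e^{tzQ}\|<\infty\},\\ \mathcal K_Q&=\{z\in\mathbb C:\ \sup_{\operatorname{Re}s>-1/2}(|s+1|-|s|)\,\|(1-szQ)^{-1}\|<\infty\},\\ \mathcal K_Q^\infty&=\{z\in\mathbb C:\ \sup_{\operatorname{Re}s>-1/2,\ k\in\mathbb N}(|s+1|-|s|)^k\,\|(1-szQ)^{-k}\|<\infty\},\\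 \mathcal R_Q&=\{z\in\mathbb C:\ \sup_{\operatorname{Re}s>-1/2}\|(1-szQ)^{-1}\|<\infty\},\\ \mathcal T_Q^\alpha&=\{z\in\mathbb C:\ \limsup_{j\to\infty}(j+1)^\alpha\|zQ(1+zQ)^j\|<\infty\}\quad(\alpha>0), \end{aligned}$$ where $s$ is real in the definition of $\mathcal A_Q^k$ and complex in those of $\mathcal K_Q$, $\mathcal K_Q^\infty$ and $\mathcal R_Q$, and write $\mathcal A_Q=\mathcal A_Q^1$, $\mathcal T_Q=\mathcal T_Q^1$; $\mathcal B_{Q^2}$ is the set $\mathcal B$ of the operator $Q^2$. Then: 1. $\mathcal R_Q=\mathcal B_Q\cap\mathcal T_Q$; 2. $\mathcal G_Q\mathbb C_+\subset\mathcal A_Q^k$ for all $k\in\mathbb N$, and $\mathcal R_Q\mathbb C_+\subset\mathcal A_Q$; 3. $\mathcal B_Q\subset\mathcal B_Q\mathbb R_+\subset\mathcal G_Q\subset\mathcal A_Q^k$ for all $k\in\mathbb N$; 4. $\mathcal R_Q=\mathcal A_Q^k\cap\mathcal T_Q$ for all $k\in\mathbb N$; 5. $\mathcal T_Q\subset\mathcal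 T_Q^{1/2}$ and $\mathcal G_Q\cap\mathcal T_Q^{1/2}\subset\mathcal B_Q$; 6. $\mathcal R_Q=\mathcal G_Q\cap\mathcal T_Q$; 7. $\mathcal R_Q\mathbb R_+=\mathcal R_Q$; 8. $\mathcal B_Q[0,1)\subset\mathcal T_Q^{1/2}$; 9. $\mathcal B_Q\subset\mathcal K_Q$ and $\mathcal K_Q\mathbb C_+\subset\mathcal A_Q$; 10. $\mathcal B_Q\subset\mathcal K_Q^\infty\subset\mathcal G_Q\cap\mathcal K_Q$; 11. $(-\mathcal B_{Q^2})^{1/2}\cap\mathcal G_Q\subset\mathcal B_Q$. -/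

import Mathlib

open scoped Pointwise

noncomputable section

namespace Microspectral

variable {X : Type*} [NormedAddCommGroup X] [NormedSpace ℂ X]

/-- The operator `(1 - w Q)⁻¹`. For `σ(Q) = {0}` the operator `1 - w Q` is invertible for
every `w : ℂ`, so that `Ring.inverse` is the true inverse. -/
def res (Q : X →L[ℂ] X) (w : ℂ) : X →L[ℂ] X :=
  Ring.inverse (1 - w • Q)

/-- The power-bounded set: `sup_{j ≥ 1} ‖(1 + z Q) ^ j‖ < ∞`. -/
def powerBoundedSet (Q : X →L[ℂ] X) : Set ℂ :=
  {z | ∃ N : ℝ, ∀ j : ℕ, 1 ≤ j → ‖(1 + z • Q) ^ j‖ ≤ N}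

/-- The Abel set of order `k`: `limsup_{s → +∞} ‖(1 - s z Q) ^ (-k)‖ < ∞`
(for a real function that is bounded below, finiteness of the upper limit means that the
function is eventually bounded above). -/
def abelSet (Q : X →L[ℂ] X) (k : ℕ) : Set ℂ :=
  {z | Filter.IsBoundedUnder (· ≤ ·) Filter.atTop
    (fun s : ℝ => ‖res Q ((s : ℂ) * z) ^ k‖)}

/-- The Hille–Yosida set: `limsup_{t → +∞} ‖exp (t z Q)‖ < ∞`. -/
def hilleYosidaSet (Q : X →L[ℂ] X) : Set ℂ :=
  {z | Filter.IsBoundedUnder (· ≤ ·) Filter.atTop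
    (fun t : ℝ => ‖NormedSpace.exp (((t : ℂ) * z) • Q)‖)}

/-- The Kreiss set: `sup_{Re s > -1/2} (|s + 1| - |s|) ‖(1 - s z Q)⁻¹‖ < ∞`. -/
def kreissSet (Q : X →L[ℂ] X) : Set ℂ :=
  {z | ∃ M : ℝ, ∀ s : ℂ, -(1 / 2 : ℝ) < s.re →
    (‖s + 1‖ - ‖s‖) * ‖res Q (s * z)‖ ≤ M}

/-- The iterated Kreiss set:
`sup_{Re s > -1/2, k ≥ 1} (|s + 1| - |s|) ^ k ‖(1 - s z Q) ^ (-k)‖ < ∞`. -/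
def iteratedKreissSet (Q : X →L[ℂ] X) : Set ℂ :=
  {z | ∃ M : ℝ, ∀ s : ℂ, -(1 / 2 : ℝ) < s.re → ∀ k : ℕ, 1 ≤ k →
    (‖s + 1‖ - ‖s‖) ^ k * ‖res Q (s * z) ^ k‖ ≤ M}

/-- The Ritt set: `sup_{Re s > -1/2} ‖(1 - s z Q)⁻¹‖ < ∞`. -/
def rittSet (Q : X →L[ℂ] X) : Set ℂ :=
  {z | ∃ M : ℝ, ∀ s : ℂ, -(1 / 2 : ℝ) < s.re → ‖res Q (s * z)‖ ≤ M}

/-- The Tauberian set of exponent `α`: `limsup_{j → ∞} (j + 1) ^ α ‖z Q (1 + z Q) ^ j‖ < ∞`. -/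
def tauberianSet (Q : X →L[ℂ] X) (α : ℝ) : Set ℂ :=
  {z | Filter.IsBoundedUnder (· ≤ ·) Filter.atTop
    (fun j : ℕ => ((j : ℝ) + 1) ^ α * ‖(z • Q) * (1 + z • Q) ^ j‖)}

/-- The open positive real axis `(0, ∞)`, as a subset of `ℂ`. -/
def posReals : Set ℂ := (fun r : ℝ => (r : ℂ)) '' Set.Ioi 0

/-- The half-open interval `[0, 1)`, as a subset of `ℂ`. -/
def unitIco : Set ℂ := (fun r : ℝ => (r : ℂ)) '' Set.Ico 0 1

/-- The open right half-plane. -/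
def rightHalfPlane : Set ℂ := {s | 0 < s.re}

/-- The set `A ^ (1/2)` of all square roots of elements of `A`. -/
def sqrtSet (A : Set ℂ) : Set ℂ := {z | z ^ 2 ∈ A}

end Microspectral

end

namespace Microspectral

open NormedSpace Filter Topology

set_option linter.unusedSectionVars false

/-! ### Exponential series in a commutative Banach algebra -/

section CommutativeAlgebra

variable {A : Type*} [NormedCommRing A] [NormedAlgebra ℂ A] [CompleteSpace A] [NormOneClass A]

/-! Every set is defined by norms of functions of `Q`, so `Q` may be replaced by an element `q` of
its bicommutant. This is a commutative Banach algebra with the same norms and inverses, where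
identities can be checked by `ring`. Fix `z` and put `N = z q`; the spectral hypothesis says only
that `1 - w N` is a unit for every `w`.

The equalities for the Ritt set come from one cycle. A Cauchy estimate for `N (1 - z (1 + N))⁻³` on
circles inside the unit disc gives the Ritt condition's decay `‖N (1 + N) ^ j‖ = O(1/j)`
(`norm_mul_one_add_pow_le_of_norm_inverse_le`), and the Abel condition is immediate. Abel plus this
decay bounds `exp (t N)` (`exists_norm_exp_le_of_norm_inverse_le`). A bounded exponential plus the
weaker decay `O(j ^ (-1/2))` bounds the powers of `1 + N`
(`exists_norm_one_add_pow_le_of_norm_exp_le`). Bounded powers plus `O(1/j)` return the Ritt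
condition (`norm_inverse_le_of_norm_mul_one_add_pow_le`). Both Tauberian steps absorb a fraction of
the unknown bound into itself.

The other inclusions rest on averaging. The resolvent is a Laplace transform of `exp (t N)`, `exp (t
N)` is a Poisson average of the powers of `1 + N` and a limit of powers of resolvents, and `N (1 + p
N) ^ j` is a centred binomial average of those powers. -/

theorem exp_real_smul_add (N : A) (s t : ℝ) :
    exp ((s + t) • N) = exp (s • N) * exp (t • N) := by
  let _ : NormedAlgebra ℚ A := NormedAlgebra.restrictScalars ℚ ℂ A
  rw [add_smul, exp_add]

theorem exp_real_smul_nat_mul (N : A) (n : ℕ) (t : ℝ) :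
    exp ((n * t : ℝ) • N) = exp (t • N) ^ n := by
  induction n with
  | zero => simp
  | succ n ih =>
    rw [pow_succ, ← ih, ← exp_real_smul_add]
    congr 2
    push_cast
    ring

theorem norm_exp_le_exp_norm (x : A) : ‖exp x‖ ≤ Real.exp ‖x‖ := by
  have h := exp_series_hasSum_exp' (𝕂 := ℂ) x
  have h2 : HasSum (fun n : ℕ => ((n.factorial : ℝ)⁻¹) • ‖x‖ ^ n) (Real.exp ‖x‖) := by
    rw [Real.exp_eq_exp_ℝ]
    exact exp_series_hasSum_exp' (𝕂 := ℝ) ‖x‖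
  refine h.norm_le_of_bounded h2 fun n => ?_
  refine (norm_smul_le _ _).trans ?_
  rw [norm_inv, Complex.norm_natCast, smul_eq_mul]
  gcongr
  exact norm_pow_le x n

/-- Second order Taylor expansion of the exponential with a remainder in factored form. -/
theorem exists_exp_eq_one_add_add_sq_mul (x : A) :
    ∃ g : A, exp x = 1 + x + x ^ 2 * g ∧ ‖g‖ ≤ Real.exp ‖x‖ := by
  have h := exp_series_hasSum_exp' (𝕂 := ℂ) x
  have hs := expSeries_summable' (𝕂 := ℂ) x
  have h2 : HasSum (fun n : ℕ => ((n.factorial : ℝ)⁻¹) • ‖x‖ ^ n) (Real.exp ‖x‖) := by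
    rw [Real.exp_eq_exp_ℝ]
    exact exp_series_hasSum_exp' (𝕂 := ℝ) ‖x‖
  have hb : ∀ n : ℕ, ‖(((n + 2).factorial : ℂ)⁻¹) • x ^ n‖ ≤ ((n.factorial : ℝ)⁻¹) • ‖x‖ ^ n := by
    intro n
    refine (norm_smul_le _ _).trans ?_
    rw [norm_inv, Complex.norm_natCast, smul_eq_mul]
    have : (n.factorial : ℝ) ≤ ((n + 2).factorial : ℝ) := by
      exact_mod_cast Nat.factorial_le (by omega)
    have h0 : (0 : ℝ) < n.factorial := by exact_mod_cast n.factorial_pos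
    gcongr
    exact norm_pow_le x n
  have hg : Summable fun n : ℕ => (((n + 2).factorial : ℂ)⁻¹) • x ^ n :=
    Summable.of_norm_bounded h2.summable hb
  refine ⟨_, ?_, hg.hasSum.norm_le_of_bounded h2 hb⟩
  rw [← h.tsum_eq, ← hs.sum_add_tsum_nat_add 2, ← hg.tsum_mul_left]
  simp [Finset.sum_range_succ, pow_add, mul_comm]

theorem hasDerivAt_exp_real_smul (N : A) (t : ℝ) :
    HasDerivAt (fun u : ℝ => exp (u • N)) (exp (t • N) * N) t :=
  hasDerivAt_exp_smul_const N t

theorem eq_inverse_mul {a b c : A} (hb : IsUnit b) (h : b * c = a) : c = Ring.inverse b * a := by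
  rw [← h, ← mul_assoc, Ring.inverse_mul_cancel _ hb, one_mul]

/-! ### Resolvent bounds from a bounded exponential -/

/-- A bounded orbit `t ↦ exp (t N) a` stays bounded after multiplication of `a` by the
resolvent at a point of the right half-plane. -/
theorem norm_exp_mul_inverse_mul_le {N : A} (hN : ∀ w : ℂ, IsUnit (1 - w • N)) {C K : ℝ} {a : A}
    (hC : ∀ t : ℝ, 0 ≤ t → ‖exp (t • N)‖ ≤ C)
    (hK : ∀ t : ℝ, 0 ≤ t → ‖exp (t • N) * a‖ ≤ K) {w : ℂ} (hw : 0 < w.re) {t : ℝ} (ht : 0 ≤ t) :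
    ‖exp (t • N) * (Ring.inverse (1 - w • N) * a)‖ ≤ K * (‖w‖ / w.re) := by
  have hw0 : w ≠ 0 := by rintro rfl; simp at hw
  have hwn : 0 < ‖w‖ := norm_pos_iff.2 hw0
  set b := Ring.inverse (1 - w • N) * a with hb
  have hab : (1 - w • N) * b = a := by
    rw [hb, ← mul_assoc, Ring.mul_inverse_cancel _ (hN w), one_mul]
  set ρ : ℝ := (w⁻¹).re with hρ
  have hρv : ρ = w.re / ‖w‖ ^ 2 := by rw [hρ, Complex.inv_re, Complex.normSq_eq_norm_sq]
  have hρ0 : 0 < ρ := by rw [hρv]; positivity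
  -- This is the Laplace transform of the orbit in differential form: `f` has derivative of norm at
  -- most `K ‖w‖⁻¹ e ^ (-ρ u)`, whose integral over `(0, ∞)` is `K ‖w‖ / w.re`. The bound `C` only
  -- makes `f` vanish at infinity, so it does not enter the constant.
  set f : ℝ → A := fun u => Complex.exp (-w⁻¹ * u) • (exp ((t + u) • N) * b) with hf
  have hexpn : ∀ u : ℝ, ‖Complex.exp (-w⁻¹ * u)‖ = Real.exp (-ρ * u) := by
    intro u
    rw [Complex.norm_exp]
    simp [hρ]
  have hfd : ∀ u : ℝ, HasDerivAt f
      (-(w⁻¹ * Complex.exp (-w⁻¹ * u)) • (exp ((t + u) • N) * a)) u := by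
    intro u
    have h1 : HasDerivAt (fun u : ℝ => Complex.exp (-w⁻¹ * u))
        (Complex.exp (-w⁻¹ * u) * (-w⁻¹ * 1)) u := by
      have := ((hasDerivAt_id (u : ℂ)).const_mul (-w⁻¹)).cexp
      exact this.comp_ofReal
    have h2 : HasDerivAt (fun u : ℝ => exp ((t + u) • N) * b)
        (exp ((t + u) • N) * N * b) u :=
      ((hasDerivAt_exp_real_smul N (t + u)).comp_const_add t u).mul_const b
    refine (h1.smul h2).congr_deriv ?_
    rw [← hab]
    generalize exp ((t + u) • N) = e
    simp only [Algebra.smul_def, map_neg, map_mul, mul_one]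
    have : algebraMap ℂ A w⁻¹ * algebraMap ℂ A w = 1 := by
      rw [← map_mul, inv_mul_cancel₀ hw0, map_one]
    linear_combination -(algebraMap ℂ A (Complex.exp (-w⁻¹ * u)) * e * N * b) * this
  have hK0 : 0 ≤ K := (norm_nonneg _).trans (hK 0 le_rfl)
  have hbound : ∀ u : ℝ, 0 ≤ u → ‖f u - f 0‖ ≤ K * (‖w‖ / w.re) * (1 - Real.exp (-ρ * u)) := by
    intro u hu
    have hB : ∀ x : ℝ, HasDerivAt (fun x => K * (‖w‖ / w.re) * (1 - Real.exp (-ρ * x)))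
        (K * ‖w‖⁻¹ * Real.exp (-ρ * x)) x := by
      intro x
      have := (((((hasDerivAt_id x).const_mul (-ρ)).exp).const_sub 1).const_mul
        (K * (‖w‖ / w.re)))
      refine this.congr_deriv ?_
      rw [hρv]
      simp only [id]
      field_simp
    refine image_norm_le_of_norm_deriv_right_le_deriv_boundary (f := fun u => f u - f 0) (a := 0)
      (b := u) (f' := fun u => -(w⁻¹ * Complex.exp (-w⁻¹ * u)) • (exp ((t + u) • N) * a))
      ?_ ?_ (by simp) hB ?_ (Set.right_mem_Icc.2 hu)
    · exact fun x _ => ((hfd x).sub_const _).continuousAt.continuousWithinAt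
    · exact fun x _ => ((hfd x).sub_const _).hasDerivWithinAt
    · intro x hx
      refine (norm_smul_le _ _).trans ?_
      rw [norm_neg, norm_mul, hexpn, norm_inv]
      have := hK (t + x) (by linarith [hx.1])
      calc _ ≤ ‖w‖⁻¹ * Real.exp (-ρ * x) * K := by gcongr
        _ = _ := by ring
  have hf0 : f 0 = exp (t • N) * b := by simp [hf]
  have hle : ∀ u : ℝ, 0 ≤ u →
      ‖exp (t • N) * b‖ ≤ K * (‖w‖ / w.re) + Real.exp (-ρ * u) * (C * ‖b‖) := by
    intro u hu
    have h1 := hbound u hu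
    have h2 : ‖f u‖ ≤ Real.exp (-ρ * u) * (C * ‖b‖) := by
      refine (norm_smul_le _ _).trans ?_
      rw [hexpn]
      gcongr
      exact (norm_mul_le _ _).trans
        (mul_le_mul_of_nonneg_right (hC _ (by linarith)) (norm_nonneg _))
    have h3 : ‖f 0‖ ≤ ‖f u‖ + ‖f u - f 0‖ := by
      simpa using norm_sub_le (f u) (f u - f 0)
    rw [hf0] at h3
    have h4 : K * (‖w‖ / w.re) * (1 - Real.exp (-ρ * u)) ≤ K * (‖w‖ / w.re) := by
      apply mul_le_of_le_one_right (by positivity)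
      linarith [Real.exp_pos (-ρ * u)]
    linarith [hf0 ▸ h1]
  have hlim : Tendsto (fun u : ℝ => K * (‖w‖ / w.re) + Real.exp (-ρ * u) * (C * ‖b‖)) atTop
      (𝓝 (K * (‖w‖ / w.re) + 0 * (C * ‖b‖))) := by
    refine tendsto_const_nhds.add (Tendsto.mul_const _ ?_)
    have : Tendsto (fun u : ℝ => -ρ * u) atTop atBot :=
      tendsto_id.const_mul_atTop_of_neg (by linarith)
    exact Real.tendsto_exp_atBot.comp this
  rw [zero_mul, add_zero] at hlim
  exact ge_of_tendsto hlim ((eventually_ge_atTop 0).mono hle)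

theorem norm_inverse_le_of_norm_exp_le {N : A} (hN : ∀ w : ℂ, IsUnit (1 - w • N)) {C : ℝ}
    (hC : ∀ t : ℝ, 0 ≤ t → ‖exp (t • N)‖ ≤ C) {w : ℂ} (hw : 0 < w.re) :
    ‖Ring.inverse (1 - w • N)‖ ≤ C * (‖w‖ / w.re) := by
  simpa using norm_exp_mul_inverse_mul_le hN (a := 1) hC (by simpa using hC) hw le_rfl

/-- At `w = 1` the factor `‖w‖ / w.re` is `1`, so the previous estimate can be iterated with no
growth in `j`. -/
theorem norm_exp_mul_inverse_pow_le {N : A} (hN : ∀ w : ℂ, IsUnit (1 - w • N)) {C : ℝ}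
    (hC : ∀ t : ℝ, 0 ≤ t → ‖exp (t • N)‖ ≤ C) (j : ℕ) {t : ℝ} (ht : 0 ≤ t) :
    ‖exp (t • N) * Ring.inverse (1 - N) ^ j‖ ≤ C := by
  induction j generalizing t with
  | zero => simpa using hC t ht
  | succ j ih =>
    have h := norm_exp_mul_inverse_mul_le hN (a := Ring.inverse (1 - N) ^ j) hC (fun t => ih)
      (w := 1) (by simp) ht
    simpa [pow_succ'] using h

/-- If `exp (t N)` and the powers of `1 - N ^ 2` are bounded, then so are the powers of
`1 + N`. -/
theorem norm_one_add_pow_le_of_norm_one_sub_sq_pow_le {N : A} (hN : ∀ w : ℂ, IsUnit (1 - w • N))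
    {C D : ℝ} (hC : ∀ t : ℝ, 0 ≤ t → ‖exp (t • N)‖ ≤ C) {j : ℕ}
    (hD : ‖(1 - N ^ 2) ^ j‖ ≤ D) : ‖(1 + N) ^ j‖ ≤ D * C := by
  have hu : IsUnit (1 - N) := by simpa using hN 1
  have h : (1 + N) ^ j = (1 - N ^ 2) ^ j * Ring.inverse (1 - N) ^ j := by
    rw [← mul_pow, show 1 - N ^ 2 = (1 + N) * (1 - N) by ring, mul_assoc,
      Ring.mul_inverse_cancel _ hu, mul_one]
  have h2 := norm_exp_mul_inverse_pow_le hN hC j le_rfl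
  rw [zero_smul, exp_zero, one_mul] at h2
  rw [h]
  exact (norm_mul_le _ _).trans (mul_le_mul hD h2 (norm_nonneg _) ((norm_nonneg _).trans hD))

/-! ### Poisson averages of the powers of `1 + N` -/

/-- `exp (t N)` is the Poisson average of the powers of `1 + N`. -/
theorem hasSum_poisson_mul_one_add_pow (N a : A) (t : ℝ) :
    HasSum (fun j : ℕ => (Real.exp (-t) * ((j.factorial : ℝ)⁻¹ * t ^ j)) • (a * (1 + N) ^ j))
      (a * exp (t • N)) := by
  let _ : NormedAlgebra ℚ A := NormedAlgebra.restrictScalars ℚ ℂ A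
  have h := (exp_series_hasSum_exp' (𝕂 := ℝ) (t • (1 + N))).mul_left a
  have h2 := h.const_smul (Real.exp (-t))
  have he : exp (t • (1 + N)) = Real.exp t • exp (t • N) := by
    rw [smul_add, exp_add, ← Algebra.algebraMap_eq_smul_one, ← algebraMap_exp_comm,
      ← Real.exp_eq_exp_ℝ, Algebra.smul_def (Real.exp t), Algebra.smul_def t]
  rw [he, mul_smul_comm, smul_smul, ← Real.exp_add, neg_add_cancel, Real.exp_zero, one_smul] at h2
  refine h2.congr_fun fun j => ?_
  rw [smul_pow, smul_smul, mul_smul_comm, smul_smul]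

theorem norm_mul_exp_le_of_hasSum {N a : A} {t S : ℝ} (ht : 0 ≤ t) {c : ℕ → ℝ}
    (hc : ∀ j, ‖a * (1 + N) ^ j‖ ≤ c j)
    (hS : HasSum (fun j : ℕ => (j.factorial : ℝ)⁻¹ * t ^ j * c j) S) :
    ‖a * exp (t • N)‖ ≤ Real.exp (-t) * S := by
  refine (hasSum_poisson_mul_one_add_pow N a t).norm_le_of_bounded (hS.mul_left _) fun j => ?_
  refine (norm_smul_le _ _).trans ?_
  rw [Real.norm_of_nonneg (by positivity)]
  calc _ ≤ Real.exp (-t) * ((j.factorial : ℝ)⁻¹ * t ^ j) * c j := by gcongr; exact hc j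
    _ = _ := by ring

theorem hasSum_real_exp (t : ℝ) :
    HasSum (fun j : ℕ => (j.factorial : ℝ)⁻¹ * t ^ j) (Real.exp t) := by
  rw [Real.exp_eq_exp_ℝ]
  exact exp_series_hasSum_exp' (𝕂 := ℝ) t

theorem hasSum_real_exp_div_succ {t : ℝ} (ht : t ≠ 0) :
    HasSum (fun j : ℕ => (j.factorial : ℝ)⁻¹ * t ^ j * (j + 1 : ℝ)⁻¹) ((Real.exp t - 1) / t) := by
  have h := (hasSum_nat_add_iff' 1).2 (hasSum_real_exp t)
  have h2 := h.div_const t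
  simp only [Finset.range_one, Finset.sum_singleton, Nat.factorial_zero, Nat.cast_one, inv_one,
    pow_zero, mul_one] at h2
  refine h2.congr_fun fun j => ?_
  rw [Nat.factorial_succ]
  push_cast
  have : (j.factorial : ℝ) ≠ 0 := by exact_mod_cast j.factorial_ne_zero
  have h3 : (j + 1 : ℝ) ≠ 0 := by positivity
  field_simp
  ring

theorem norm_exp_le_of_norm_one_add_pow_le {N : A} {C : ℝ} (hC : ∀ j : ℕ, ‖(1 + N) ^ j‖ ≤ C)
    {t : ℝ} (ht : 0 ≤ t) : ‖exp (t • N)‖ ≤ C := by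
  have h := norm_mul_exp_le_of_hasSum (N := N) (a := 1) ht (c := fun _ => C) (by simpa using hC)
    ((hasSum_real_exp t).mul_right C)
  rwa [one_mul, ← mul_assoc, ← Real.exp_add, neg_add_cancel, Real.exp_zero, one_mul] at h

theorem norm_mul_exp_le_div {N : A} {C : ℝ} (hC0 : 0 ≤ C)
    (hC : ∀ j : ℕ, ‖N * (1 + N) ^ j‖ ≤ C / (j + 1)) {t : ℝ} (ht : 0 < t) :
    ‖N * exp (t • N)‖ ≤ C / t := by
  have h := norm_mul_exp_le_of_hasSum (N := N) (a := N) ht.le (c := fun j => (j + 1 : ℝ)⁻¹ * C)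
    (fun j => (hC j).trans_eq (by rw [div_eq_inv_mul]))
    (by simpa only [mul_assoc] using (hasSum_real_exp_div_succ ht.ne').mul_right C)
  refine h.trans ?_
  have h1 : Real.exp (-t) * Real.exp t = 1 := by rw [← Real.exp_add]; simp
  have h2 : Real.exp (-t) * ((Real.exp t - 1) / t * C) = (1 - Real.exp (-t)) * (C / t) := by
    field_simp
    linear_combination C * h1
  rw [h2]
  exact mul_le_of_le_one_left (by positivity) (by linarith [Real.exp_pos (-t)])

theorem norm_mul_exp_le_div_sqrt {N : A} {C : ℝ} (hC0 : 0 ≤ C)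
    (hC : ∀ j : ℕ, ‖N * (1 + N) ^ j‖ ≤ C / √(j + 1)) {t : ℝ} (ht : 0 < t) :
    ‖N * exp (t • N)‖ ≤ C / √t := by
  have hst : 0 < √t := Real.sqrt_pos.2 ht
  have hsq : √t ^ 2 = t := Real.sq_sqrt ht.le
  -- By the arithmetic-geometric mean inequality `1/√(j+1)` is at most half of `√t/(j+1) + 1/√t`.
  -- Both of these have explicit Poisson sums, and the weight `√t` balances them.
  have hc : ∀ j : ℕ, ‖N * (1 + N) ^ j‖ ≤
      (C / 2 * √t) * (j + 1 : ℝ)⁻¹ + C / 2 / √t := by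
    intro j
    refine (hC j).trans ?_
    have hj : (0 : ℝ) < √(j + 1) := Real.sqrt_pos.2 (by positivity)
    have hj2 : √((j : ℝ) + 1) ^ 2 = j + 1 := Real.sq_sqrt (by positivity)
    rw [← hj2]
    have : (C / 2 * √t) * (√((j : ℝ) + 1) ^ 2)⁻¹ + C / 2 / √t - C / √(j + 1) =
        C / 2 * √t * ((√((j : ℝ) + 1))⁻¹ - (√t)⁻¹) ^ 2 := by
      field_simp
      ring
    have h2 : 0 ≤ C / 2 * √t * ((√((j : ℝ) + 1))⁻¹ - (√t)⁻¹) ^ 2 := by positivity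
    rw [hj2] at this ⊢
    linarith
  have h := norm_mul_exp_le_of_hasSum ht.le hc (S := C / 2 * √t * ((Real.exp t - 1) / t)
    + C / 2 / √t * Real.exp t) (by
      have h1 := (hasSum_real_exp_div_succ ht.ne').mul_left (C / 2 * √t)
      have h2 := (hasSum_real_exp t).mul_left (C / 2 / √t)
      refine (h1.add h2).congr_fun ?_
      intro j
      ring)
  refine h.trans ?_
  have h1 : Real.exp (-t) * Real.exp t = 1 := by rw [← Real.exp_add]; simp
  have h2 : Real.exp (-t) * (C / 2 * √t * ((Real.exp t - 1) / t) + C / 2 / √t * Real.exp t) =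
      (1 - Real.exp (-t)) * (C / 2 / √t) + C / 2 / √t := by
    have h3 : C / 2 * √t * ((Real.exp t - 1) / t) = C / 2 / √t * (Real.exp t - 1) := by
      field_simp
      rw [hsq]
      ring
    rw [h3]
    linear_combination C / √t * h1
  rw [h2]
  have h3 : (1 - Real.exp (-t)) * (C / 2 / √t) ≤ C / 2 / √t :=
    mul_le_of_le_one_left (by positivity) (by linarith [Real.exp_pos (-t)])
  calc _ ≤ C / 2 / √t + C / 2 / √t := by linarith
    _ = C / √t := by ring

/-! ### Kreiss conditions -/

/-- The line `Re s = -1/2` is the perpendicular bisector of `-1` and `0`; this makes the Kreiss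
weight positive. -/
theorem norm_lt_norm_add_one {s : ℂ} (hs : -(1 / 2 : ℝ) < s.re) : ‖s‖ < ‖s + 1‖ := by
  have h : ‖s‖ ^ 2 < ‖s + 1‖ ^ 2 := by
    rw [← Complex.normSq_eq_norm_sq, ← Complex.normSq_eq_norm_sq, Complex.normSq_apply,
      Complex.normSq_apply]
    simp only [Complex.add_re, Complex.add_im, Complex.one_re, Complex.one_im]
    nlinarith
  exact lt_of_pow_lt_pow_left₀ 2 (norm_nonneg _) h

/-- The supremum `S` of the orbit of `b` satisfies `‖s + 1‖ S ≤ ‖s‖ S + K`, because `(s + 1) b = s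
(1 + N) b + a`. The bound `C` only makes `S` finite; its absence from the conclusion allows
iteration over powers of the resolvent. -/
theorem norm_one_add_pow_mul_inverse_mul_le {N : A} (hN : ∀ w : ℂ, IsUnit (1 - w • N)) {C K : ℝ}
    {a : A} (hC : ∀ j : ℕ, ‖(1 + N) ^ j‖ ≤ C) (hK : ∀ j : ℕ, ‖(1 + N) ^ j * a‖ ≤ K) {s : ℂ}
    (hs : -(1 / 2 : ℝ) < s.re) (j : ℕ) :
    ‖(1 + N) ^ j * (Ring.inverse (1 - s • N) * a)‖ ≤ K / (‖s + 1‖ - ‖s‖) := by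
  set b := Ring.inverse (1 - s • N) * a with hb
  have hab : (1 - s • N) * b = a := by
    rw [hb, ← mul_assoc, Ring.mul_inverse_cancel _ (hN s), one_mul]
  have hlt := norm_lt_norm_add_one hs
  have hbdd : BddAbove (Set.range fun j : ℕ => ‖(1 + N) ^ j * b‖) := by
    refine ⟨C * ‖b‖, ?_⟩
    rintro _ ⟨i, rfl⟩
    exact (norm_mul_le _ _).trans (mul_le_mul_of_nonneg_right (hC i) (norm_nonneg _))
  set S := ⨆ j : ℕ, ‖(1 + N) ^ j * b‖ with hS
  have hpos : 0 < ‖s + 1‖ := (norm_nonneg s).trans_lt hlt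
  have hi : ∀ i : ℕ, ‖(1 + N) ^ i * b‖ ≤ (‖s‖ * S + K) / ‖s + 1‖ := by
    intro i
    rw [le_div_iff₀' hpos, ← norm_smul]
    have h : (s + 1) • ((1 + N) ^ i * b) = s • ((1 + N) ^ (i + 1) * b) + (1 + N) ^ i * a := by
      rw [← hab]
      simp only [Algebra.smul_def, map_add, map_one]
      ring
    rw [h]
    refine (norm_add_le _ _).trans (add_le_add ?_ (hK i))
    rw [norm_smul]
    gcongr
    exact le_ciSup hbdd (i + 1)
  have hSle : S ≤ (‖s‖ * S + K) / ‖s + 1‖ := ciSup_le hi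
  rw [le_div_iff₀ hpos] at hSle
  refine (le_ciSup hbdd j).trans ?_
  rw [le_div_iff₀ (by linarith)]
  linarith

theorem norm_one_add_pow_mul_inverse_pow_le {N : A} (hN : ∀ w : ℂ, IsUnit (1 - w • N)) {C : ℝ}
    (hC : ∀ j : ℕ, ‖(1 + N) ^ j‖ ≤ C) {s : ℂ} (hs : -(1 / 2 : ℝ) < s.re) (k j : ℕ) :
    ‖(1 + N) ^ j * Ring.inverse (1 - s • N) ^ k‖ ≤ C / (‖s + 1‖ - ‖s‖) ^ k := by
  induction k generalizing j with
  | zero => simpa using hC j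
  | succ k ih =>
    have h := norm_one_add_pow_mul_inverse_mul_le hN hC ih hs j
    rwa [← pow_succ', div_div, ← pow_succ] at h

/-- Power boundedness of `1 + N` implies the iterated Kreiss condition. -/
theorem mul_norm_inverse_pow_le {N : A} (hN : ∀ w : ℂ, IsUnit (1 - w • N)) {C : ℝ}
    (hC : ∀ j : ℕ, ‖(1 + N) ^ j‖ ≤ C) {s : ℂ} (hs : -(1 / 2 : ℝ) < s.re) (k : ℕ) :
    (‖s + 1‖ - ‖s‖) ^ k * ‖Ring.inverse (1 - s • N) ^ k‖ ≤ C := by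
  have h := norm_one_add_pow_mul_inverse_pow_le hN hC hs k 0
  rw [pow_zero, one_mul] at h
  have hlt := norm_lt_norm_add_one hs
  rwa [le_div_iff₀' (pow_pos (by linarith) k)] at h

/-- The difference of the squares is `2 r c.re + 1`, and the sum of the norms is at most `r (2 ‖c‖ +
1)` for `r ≥ 1`. The quotient bounds the Kreiss weight below along a ray, uniformly in `r`. -/
theorem le_norm_mul_add_one_sub_norm {c : ℂ} (hc : 0 < c.re) {r : ℝ} (hr : 1 ≤ r) :
    2 * c.re / (2 * ‖c‖ + 1) ≤ ‖(r : ℂ) * c + 1‖ - ‖(r : ℂ) * c‖ := by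
  have h0 : 0 < r := by linarith
  have hn : ‖(r : ℂ) * c‖ = r * ‖c‖ := by
    rw [norm_mul, Complex.norm_real, Real.norm_of_nonneg h0.le]
  have h1 : ‖(r : ℂ) * c + 1‖ ≤ r * ‖c‖ + 1 := by
    simpa [hn, abs_of_pos h0] using norm_add_le ((r : ℂ) * c) 1
  have h2 : ‖(r : ℂ) * c + 1‖ ^ 2 = ‖(r : ℂ) * c‖ ^ 2 + 2 * r * c.re + 1 := by
    rw [← Complex.normSq_eq_norm_sq, ← Complex.normSq_eq_norm_sq, Complex.normSq_apply,
      Complex.normSq_apply]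
    simp
    ring
  have h3 : ‖(r : ℂ) * c‖ ≤ ‖(r : ℂ) * c + 1‖ := by
    apply (norm_lt_norm_add_one _).le
    simp only [Complex.mul_re, Complex.ofReal_re, Complex.ofReal_im, zero_mul, sub_zero]
    nlinarith
  rw [hn] at h2 h3 ⊢
  have hcn := norm_nonneg c
  rw [div_le_iff₀ (by positivity)]
  set x := ‖(r : ℂ) * c + 1‖
  have h4 : (x - r * ‖c‖) * (x + r * ‖c‖) ≤ (x - r * ‖c‖) * (r * (2 * ‖c‖ + 1)) := by
    apply mul_le_mul_of_nonneg_left _ (by linarith)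
    nlinarith
  have h5 : r * (2 * c.re) ≤ r * ((x - r * ‖c‖) * (2 * ‖c‖ + 1)) := by nlinarith
  exact le_of_mul_le_mul_left h5 h0

theorem norm_le_of_mul_norm_le {B : Type*} [NormedAddCommGroup B] {F : ℂ → B} {M : ℝ}
    (hM : ∀ s : ℂ, -(1 / 2 : ℝ) < s.re → (‖s + 1‖ - ‖s‖) * ‖F s‖ ≤ M) {c : ℂ} (hc : 0 < c.re)
    {r : ℝ} (hr : 1 ≤ r) : ‖F ((r : ℂ) * c)‖ ≤ M / (2 * c.re / (2 * ‖c‖ + 1)) := by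
  have h := le_norm_mul_add_one_sub_norm hc hr
  have hpos : 0 < 2 * c.re / (2 * ‖c‖ + 1) := by positivity
  rw [le_div_iff₀' hpos]
  refine (mul_le_mul_of_nonneg_right h (norm_nonneg _)).trans (hM _ ?_)
  simp only [Complex.mul_re, Complex.ofReal_re, Complex.ofReal_im, zero_mul, sub_zero]
  nlinarith

/-- A bound for the powers of the resolvent on the positive half-line bounds the exponential. -/
theorem norm_exp_le_of_norm_inverse_pow_le {N : A} (hN : ∀ w : ℂ, IsUnit (1 - w • N)) {M : ℝ}
    (hM : ∀ s : ℝ, 0 < s → ∀ k : ℕ, 1 ≤ k → ‖Ring.inverse (1 - (s : ℂ) • N) ^ k‖ ≤ M)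
    {t : ℝ} (ht : 0 < t) : ‖exp (t • N)‖ ≤ M := by
  set D := t * ‖N‖ with hD
  have hD0 : 0 ≤ D := by positivity
  set c := D ^ 2 * (1 + (1 + D) * Real.exp D) with hc
  have hM0 : 0 ≤ M := (norm_nonneg _).trans (hM 1 one_pos 1 le_rfl)
  -- Quantitative form of `exp (t N) = lim (1 - t N / n) ^ (-n)`. With `x = t N / (n + 1)`, the
  -- correction `(1 - x) exp x` is `1 + O(x ^ 2)`, so its power `n + 1` has norm at most `exp (c /
  -- (n + 1))`, which tends to `1`.
  have key : ∀ n : ℕ, ‖exp (t • N)‖ ≤ M * Real.exp (c * (1 / ((n : ℝ) + 1))) := by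
    intro n
    set h : ℝ := t / (n + 1) with hh
    have hn : (0 : ℝ) < n + 1 := by positivity
    have hh0 : 0 < h := by positivity
    set x : A := h • N with hx
    have hxn : ‖x‖ = D / (n + 1) := by
      rw [hx, norm_smul, Real.norm_of_nonneg hh0.le, hh, hD]
      ring
    have hxD : ‖x‖ ≤ D := by
      rw [hxn]
      exact div_le_self hD0 (by linarith [n.cast_nonneg (α := ℝ)])
    obtain ⟨g, hg, hgn⟩ := exists_exp_eq_one_add_add_sq_mul x
    have hgD : ‖g‖ ≤ Real.exp D := hgn.trans (Real.exp_le_exp.2 hxD)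
    have hxs : 1 - (h : ℂ) • N = 1 - x := by rw [hx, Complex.coe_smul]
    have hinv : Ring.inverse (1 - (h : ℂ) • N) * (1 - x) = 1 := by
      rw [← hxs]; exact Ring.inverse_mul_cancel _ (hN _)
    have hexp : exp (t • N) = Ring.inverse (1 - (h : ℂ) • N) ^ (n + 1) *
        ((1 - x) * exp x) ^ (n + 1) := by
      rw [← mul_pow, ← mul_assoc, hinv, one_mul, hx, ← exp_real_smul_nat_mul]
      congr 2
      rw [hh]
      push_cast
      field_simp
    have heps : (1 - x) * exp x = 1 + x ^ 2 * (-1 + (1 - x) * g) := by rw [hg]; ring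
    have hbr : ‖(1 - x) * exp x‖ ≤ Real.exp (c / (n + 1) ^ 2) := by
      rw [heps]
      have h1 : ‖-1 + (1 - x) * g‖ ≤ 1 + (1 + D) * Real.exp D := by
        refine (norm_add_le _ _).trans ?_
        rw [norm_neg, norm_one]
        gcongr
        refine (norm_mul_le _ _).trans ?_
        gcongr
        refine (norm_sub_le _ _).trans ?_
        rw [norm_one]
        gcongr
      calc _ ≤ ‖(1 : A)‖ + ‖x ^ 2 * (-1 + (1 - x) * g)‖ := norm_add_le _ _
        _ ≤ 1 + ‖x‖ ^ 2 * (1 + (1 + D) * Real.exp D) := by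
            rw [norm_one]
            gcongr
            refine (norm_mul_le _ _).trans ?_
            gcongr
            exact norm_pow_le x 2
        _ = c / (n + 1) ^ 2 + 1 := by rw [hxn, hc, div_pow]; ring
        _ ≤ _ := Real.add_one_le_exp _
    rw [hexp]
    refine (norm_mul_le _ _).trans ?_
    gcongr
    · exact hM h hh0 _ (by omega)
    · refine (norm_pow_le _ _).trans ((pow_le_pow_left₀ (norm_nonneg _) hbr _).trans_eq ?_)
      rw [← Real.exp_nat_mul]
      congr 1
      push_cast
      field_simp
  have hlim : Tendsto (fun n : ℕ => M * Real.exp (c * (1 / ((n : ℝ) + 1)))) atTop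
      (𝓝 (M * Real.exp (c * 0))) :=
    ((Real.continuous_exp.tendsto _).comp
      (tendsto_one_div_add_atTop_nhds_zero_nat.const_mul c)).const_mul M
  rw [mul_zero, Real.exp_zero, mul_one] at hlim
  exact ge_of_tendsto' hlim key

/-! ### Binomial averages -/

/-- Apply `T d/dT` to the binomial expansion of `(q + p T) ^ (j + 1)` and subtract the mean. For `T
= 1 + N` the factors `T - 1` and `q + p T` become `N` and `1 + p N`. -/
theorem sum_choose_mul_sub_mul_pow {R : Type*} [CommRing R] {p q : R} (hpq : p + q = 1) (T : R)
    (j : ℕ) :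
    ∑ i ∈ Finset.range (j + 2), ((j + 1).choose i : R) * p ^ i * q ^ (j + 1 - i) *
      (i - (j + 1) * p) * T ^ i = (j + 1) * p * q * ((T - 1) * (q + p * T) ^ j) := by
  have h1 : ∑ i ∈ Finset.range (j + 2), ((j + 1).choose i : R) * p ^ i * q ^ (j + 1 - i) * T ^ i =
      (q + p * T) ^ (j + 1) := by
    rw [add_comm q, add_pow]
    refine Finset.sum_congr rfl fun i _ => ?_
    ring
  have h2 : ∑ i ∈ Finset.range (j + 2),
      ((j + 1).choose i : R) * p ^ i * q ^ (j + 1 - i) * i * T ^ i =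
      (j + 1) * p * T * (q + p * T) ^ j := by
    rw [Finset.sum_range_succ', add_comm q, add_pow, Finset.mul_sum]
    simp only [Nat.cast_zero, mul_zero, zero_mul, add_zero]
    refine Finset.sum_congr rfl fun i _ => ?_
    have h := Nat.add_one_mul_choose_eq j i
    have h' : ((j : R) + 1) * (j.choose i : R) = ((j + 1).choose (i + 1) : R) * (i + 1) := by
      have := congrArg (Nat.cast (R := R)) h
      push_cast at this
      exact this
    rw [Nat.add_sub_add_right]
    push_cast
    linear_combination -(p ^ (i + 1) * q ^ (j - i) * T ^ (i + 1)) * h'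
  calc _ = ∑ i ∈ Finset.range (j + 2),
        ((j + 1).choose i : R) * p ^ i * q ^ (j + 1 - i) * i * T ^ i - (j + 1) * p *
        ∑ i ∈ Finset.range (j + 2),
          ((j + 1).choose i : R) * p ^ i * q ^ (j + 1 - i) * T ^ i := by
        rw [Finset.mul_sum, ← Finset.sum_sub_distrib]
        refine Finset.sum_congr rfl fun i _ => ?_
        ring
    _ = _ := by
        rw [h1, h2]
        linear_combination -((j + 1) * p * T * (q + p * T) ^ j) * hpq

/-- Cauchy–Schwarz bounds the mean absolute deviation by the standard deviation; the binomial
variance is `n p (1 - p)`. -/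
theorem sum_binomial_mul_abs_sub_le {p : ℝ} (hp : 0 ≤ p) (hp1 : p ≤ 1) (n : ℕ) :
    ∑ i ∈ Finset.range (n + 1), (n.choose i : ℝ) * p ^ i * (1 - p) ^ (n - i) * |i - n * p| ≤
      √(n * p * (1 - p)) := by
  have hq : 0 ≤ 1 - p := by linarith
  set w : ℕ → ℝ := fun i => (n.choose i : ℝ) * p ^ i * (1 - p) ^ (n - i) with hw
  have hw0 : ∀ i, 0 ≤ w i := fun i => by positivity
  have hsum : ∑ i ∈ Finset.range (n + 1), w i = 1 := by
    have := add_pow p (1 - p) n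
    rw [add_sub_cancel, one_pow] at this
    rw [this]
    refine Finset.sum_congr rfl fun i _ => ?_
    simp only [hw]; ring
  have hvar : ∑ i ∈ Finset.range (n + 1), w i * (i - n * p) ^ 2 = n * p * (1 - p) := by
    have h := congrArg (Polynomial.eval p) (bernsteinPolynomial.variance ℝ n)
    rw [Polynomial.eval_finsetSum] at h
    simp only [bernsteinPolynomial, Polynomial.eval_mul, Polynomial.eval_pow, Polynomial.eval_sub,
      Polynomial.eval_X, Polynomial.eval_natCast, Polynomial.eval_one,
      nsmul_eq_mul] at h
    rw [← h]
    refine Finset.sum_congr rfl fun i _ => ?_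
    simp only [hw]; ring
  have hcs := Finset.sum_sq_le_sum_mul_sum_of_sq_le_mul (Finset.range (n + 1))
    (r := fun i => w i * |i - n * p|) (f := w) (g := fun i => w i * (i - n * p) ^ 2)
    (fun i _ => hw0 i) (fun i _ => mul_nonneg (hw0 i) (sq_nonneg _))
    (fun i _ => by rw [mul_pow, sq_abs]; exact le_of_eq (by ring))
  rw [hsum, hvar, one_mul] at hcs
  exact Real.le_sqrt_of_sq_le hcs

/-- If `1 + N` is power bounded, then `N (1 + p N) ^ j` decays like `j ^ (-1/2)` for
`0 < p < 1`. -/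
theorem norm_mul_one_add_smul_pow_le {N : A} {C : ℝ} (hC : ∀ j : ℕ, ‖(1 + N) ^ j‖ ≤ C) {p : ℝ}
    (hp : 0 < p) (hp1 : p < 1) (j : ℕ) :
    ‖N * (1 + p • N) ^ j‖ ≤ C / √(p * (1 - p)) / √(j + 1) := by
  have hq : 0 < 1 - p := by linarith
  have hC0 : 0 ≤ C := (norm_nonneg _).trans (hC 0)
  have h := sum_choose_mul_sub_mul_pow (p := algebraMap ℝ A p) (q := algebraMap ℝ A (1 - p))
    (by rw [← map_add]; simp) (1 + N) j
  have hid : ((j + 1 : ℝ) * p * (1 - p)) • (N * (1 + p • N) ^ j) =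
      ∑ i ∈ Finset.range (j + 2), (((j + 1).choose i : ℝ) * p ^ i * (1 - p) ^ (j + 1 - i) *
        (i - (j + 1 : ℕ) * p)) • (1 + N) ^ i := by
    simp only [Algebra.smul_def, map_mul, map_natCast, map_pow, map_sub, map_one, map_add]
    simp only [map_sub, map_one] at h
    push_cast
    rw [h]
    ring
  have hn : ‖((j + 1 : ℝ) * p * (1 - p)) • (N * (1 + p • N) ^ j)‖ ≤
      C * √((j + 1 : ℕ) * p * (1 - p)) := by
    rw [hid]
    refine (norm_sum_le _ _).trans ?_
    refine le_trans ?_ (mul_le_mul_of_nonneg_left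
      (sum_binomial_mul_abs_sub_le hp.le hp1.le (j + 1)) hC0)
    rw [Finset.mul_sum]
    refine Finset.sum_le_sum fun i _ => ?_
    refine (norm_smul_le _ _).trans ?_
    rw [norm_mul, Real.norm_eq_abs, Real.norm_eq_abs, mul_comm C,
      abs_of_nonneg (a := _ * (1 - p) ^ (j + 1 - i)) (by positivity)]
    gcongr
    exact hC i
  have hj : (0 : ℝ) < j + 1 := by positivity
  have hv : 0 < (j + 1 : ℝ) * p * (1 - p) := by positivity
  rw [norm_smul, Real.norm_of_nonneg hv.le] at hn
  push_cast at hn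
  have hs : √((j + 1 : ℝ) * p * (1 - p)) = √(p * (1 - p)) * √(j + 1) := by
    rw [← Real.sqrt_mul (by positivity)]
    congr 1
    ring
  rw [div_div, ← hs, le_div_iff₀ (Real.sqrt_pos.2 hv)]
  have h2 := Real.mul_self_sqrt hv.le
  have h3 := Real.sqrt_pos.2 hv
  refine le_of_mul_le_mul_right ?_ h3
  rw [mul_assoc, h2, mul_comm]
  exact hn

/-! ### From the Abel condition to a bounded exponential -/

theorem hasDerivAt_inverse_one_sub_smul {B : A} {w : ℂ} (h : IsUnit (1 - w • B)) :
    HasDerivAt (fun z : ℂ => Ring.inverse (1 - z • B)) (B * Ring.inverse (1 - w • B) ^ 2) w := by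
  obtain ⟨u, hu⟩ := h
  have h1 : HasDerivAt (fun z : ℂ => 1 - z • B) (-((1 : ℂ) • B)) w :=
    ((hasDerivAt_id w).smul_const B).const_sub 1
  have h2 := hasFDerivAt_ringInverse (𝕜 := ℂ) u
  rw [hu] at h2
  refine (h2.comp_hasDerivAt w h1).congr_deriv ?_
  rw [← hu, Ring.inverse_unit]
  simp only [one_smul, neg_apply, ContinuousLinearMap.mulLeftRight_apply]
  ring

theorem inverse_eq_one_add {N : A} {w : ℂ} (h : IsUnit (1 - w • N)) :
    Ring.inverse (1 - w • N) = 1 + w • (N * Ring.inverse (1 - w • N)) := by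
  have := Ring.inverse_mul_cancel _ h
  simp only [Algebra.smul_def] at this ⊢
  linear_combination this

/-- If `(1 - s N) ^ (-(j + 1))` is bounded for large `s`, then so is `(1 - s N) ^ (-j)`. -/
theorem norm_inverse_pow_le_of_norm_inverse_pow_succ_le {N : A}
    (hN : ∀ w : ℂ, IsUnit (1 - w • N)) {j : ℕ} {M s₀ : ℝ} (hs₀ : 0 < s₀)
    (hM : ∀ s : ℝ, s₀ ≤ s → ‖Ring.inverse (1 - (s : ℂ) • N) ^ (j + 1)‖ ≤ M) {s : ℝ}
    (hs : s₀ ≤ s) :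
    ‖Ring.inverse (1 - (s : ℂ) • N) ^ j‖ ≤ ‖Ring.inverse (1 - (s₀ : ℂ) • N) ^ j‖ + M := by
  have hM0 : 0 ≤ M := (norm_nonneg _).trans (hM _ le_rfl)
  set R : ℝ → A := fun s => Ring.inverse (1 - (s : ℂ) • N) with hR
  have hd1 : ∀ x : ℝ, HasDerivAt R (N * R x ^ 2) x := fun x =>
    ((hasDerivAt_inverse_one_sub_smul (hN x)).scomp x Complex.ofRealCLM.hasDerivAt).congr_deriv
      (by simp [hR])
  -- The derivative of `x R` is `R + x N R ^ 2 = R ^ 2`, since `R = 1 + x N R`. Hence a bound for `R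
  -- ^ (j + 1)` integrates to one for `x ^ j R ^ j`.
  have hd2 : ∀ x : ℝ, HasDerivAt (fun x => (x • R x) ^ j) ((j * x ^ (j - 1)) • R x ^ (j + 1)) x := by
    intro x
    have h := (((hasDerivAt_id x).smul (hd1 x)).pow j)
    refine h.congr_deriv ?_
    have hx := inverse_eq_one_add (hN x)
    change R x = _ at hx
    rw [Complex.coe_smul] at hx
    change _ = 1 + x • (N * R x) at hx
    rcases j with _ | j
    · simp
    · simp only [id, Pi.smul_apply', Nat.add_sub_cancel, Algebra.smul_def, map_mul, map_pow,
        map_natCast, map_one] at hx ⊢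
      linear_combination (-(((j + 1 : ℕ) : A) * algebraMap ℝ A x ^ j * R x ^ (j + 1))) * hx
  have hB : ∀ x : ℝ, HasDerivAt (fun x => ‖(s₀ • R s₀) ^ j‖ + M * (x ^ j - s₀ ^ j))
      (M * (j * x ^ (j - 1))) x := fun x =>
    (((hasDerivAt_pow j x).sub_const _).const_mul M).const_add _
  have h := image_norm_le_of_norm_deriv_right_le_deriv_boundary (f := fun x => (x • R x) ^ j)
    (a := s₀) (b := s) (f' := fun x => (j * x ^ (j - 1)) • R x ^ (j + 1))
    (fun x _ => (hd2 x).continuousAt.continuousWithinAt)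
    (fun x _ => (hd2 x).hasDerivWithinAt) (by simp) hB
    (fun x hx => by
      have hx0 : 0 < x := hs₀.trans_le hx.1
      rw [norm_smul, Real.norm_of_nonneg (by positivity), mul_comm]
      gcongr
      exact hM x hx.1) (Set.right_mem_Icc.2 hs)
  have hs0 : 0 < s := hs₀.trans_le hs
  simp only [smul_pow, norm_smul, norm_pow, Real.norm_of_nonneg hs0.le,
    Real.norm_of_nonneg hs₀.le] at h
  have hpow : s₀ ^ j ≤ s ^ j := pow_le_pow_left₀ hs₀.le hs j
  have hpos : 0 < s ^ j := by positivity
  have hpos0 : 0 < s₀ ^ j := by positivity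
  refine le_of_mul_le_mul_left (h.trans ?_) hpos
  have h1 := mul_le_mul_of_nonneg_right hpow (norm_nonneg (R s₀ ^ j))
  have h2 : 0 ≤ M * s₀ ^ j := by positivity
  nlinarith

theorem exists_norm_inverse_le_of_norm_inverse_pow_le {N : A}
    (hN : ∀ w : ℂ, IsUnit (1 - w • N)) {k : ℕ} (hk : 1 ≤ k) {M s₀ : ℝ} (hs₀ : 0 < s₀)
    (hM : ∀ s : ℝ, s₀ ≤ s → ‖Ring.inverse (1 - (s : ℂ) • N) ^ k‖ ≤ M) :
    ∃ M' : ℝ, ∀ s : ℝ, s₀ ≤ s → ‖Ring.inverse (1 - (s : ℂ) • N)‖ ≤ M' := by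
  induction k, hk using Nat.le_induction generalizing M with
  | base => exact ⟨M, by simpa using hM⟩
  | succ k _ ih =>
    exact ih fun s hs => norm_inverse_pow_le_of_norm_inverse_pow_succ_le hN hs₀ hM hs

theorem norm_exp_sub_exp_le {N a : A} {c u v : ℝ} (huv : u ≤ v)
    (hc : ∀ t : ℝ, u ≤ t → t ≤ v → ‖N * exp (t • N) * a‖ ≤ c) :
    ‖(exp (v • N) - exp (u • N)) * a‖ ≤ c * (v - u) := by
  have h := Convex.norm_image_sub_le_of_norm_hasDerivWithin_le (s := Set.Icc u v)
    (f := fun t : ℝ => exp (t • N) * a) (f' := fun t : ℝ => exp (t • N) * N * a) (C := c)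
    (x := u) (y := v)
    (fun t _ => ((hasDerivAt_exp_real_smul N t).mul_const a).hasDerivWithinAt)
    (fun t ht => by rw [mul_comm (exp _) N]; exact hc t ht.1 ht.2) (convex_Icc u v)
    (Set.left_mem_Icc.2 huv) (Set.right_mem_Icc.2 huv)
  rwa [← sub_mul, Real.norm_of_nonneg (by linarith)] at h

/-- Tauberian theorem: if `(1 - s N)⁻¹` is bounded for large `s` and `t N exp (t N)` is bounded,
then `exp (t N)` is bounded. -/
theorem exists_norm_exp_le_of_norm_inverse_le {N : A} (hN : ∀ w : ℂ, IsUnit (1 - w • N))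
    {C M s₀ : ℝ} (hC0 : 0 ≤ C) (hC : ∀ t : ℝ, 0 < t → ‖N * exp (t • N)‖ ≤ C / t) (hs₀ : 0 < s₀)
    (hM : ∀ s : ℝ, s₀ ≤ s → ‖Ring.inverse (1 - (s : ℂ) • N)‖ ≤ M) :
    ∃ K : ℝ, ∀ t : ℝ, 0 ≤ t → ‖exp (t • N)‖ ≤ K := by
  have hM0 : 0 ≤ M := (norm_nonneg _).trans (hM _ le_rfl)
  -- Chosen so that `ε (M + 1) = 1/2`: the part of the orbit on `[0, ε s]` then costs only half of
  -- its supremum.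
  set ε : ℝ := 1 / (2 * (M + 1)) with hε
  have hε0 : 0 < ε := by positivity
  have hε1 : ε ≤ 1 := by
    rw [hε, div_le_one (by positivity)]
    linarith
  have hεM : ε * (M + 1) = 1 / 2 := by rw [hε]; field_simp
  -- Compare `exp (s N)` with the resolvent `ρ` at the same scale `s`. The Tauberian bound controls
  -- `exp (s N) (1 - ρ) = -s N exp (s N) ρ` and the change of `exp (t N) ρ` on `[ε s, s]`. On `[0, ε
  -- s]`, where `C / t` is not integrable, use `‖N ρ‖ ≤ (M + 1) / s` with the bound `m` instead.
  have key : ∀ s : ℝ, s₀ ≤ s → ∀ m : ℝ, (∀ u : ℝ, 0 ≤ u → u ≤ s → ‖exp (u • N)‖ ≤ m) →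
      ‖exp (s • N)‖ ≤ C * M + C / ε * M + M + m / 2 := by
    intro s hs m hm
    have hs0 : 0 < s := hs₀.trans_le hs
    set ρ := Ring.inverse (1 - (s : ℂ) • N) with hρ
    have hρM : ‖ρ‖ ≤ M := hM s hs
    have hρ1 : ρ = 1 + s • (N * ρ) := by
      have := inverse_eq_one_add (hN s)
      rwa [Complex.coe_smul] at this
    have hm0 : 0 ≤ m := (norm_nonneg _).trans (hm 0 le_rfl hs0.le)
    have hNρ : ‖N * ρ‖ ≤ (M + 1) / s := by
      rw [le_div_iff₀' hs0]
      calc s * ‖N * ρ‖ = ‖ρ - 1‖ := by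
            rw [show ρ - 1 = s • (N * ρ) by linear_combination hρ1, norm_smul,
              Real.norm_of_nonneg hs0.le]
        _ ≤ M + 1 := (norm_sub_le _ _).trans (by rw [norm_one]; gcongr)
    have e1 : ‖exp (s • N) * (1 - ρ)‖ ≤ C * M := by
      have : exp (s • N) * (1 - ρ) = -(s • (N * exp (s • N) * ρ)) := by
        simp only [Algebra.smul_def] at hρ1 ⊢
        linear_combination -exp ((algebraMap ℝ A) s * N) * hρ1
      rw [this, norm_neg, norm_smul, Real.norm_of_nonneg hs0.le]
      calc _ ≤ s * (‖N * exp (s • N)‖ * ‖ρ‖) := by gcongr; exact norm_mul_le _ _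
        _ ≤ s * (C / s * M) := by gcongr; exact hC s hs0
        _ = C * M := by field_simp
    have hεs : 0 < ε * s := by positivity
    have e2 : ‖(exp (s • N) - exp ((ε * s) • N)) * ρ‖ ≤ C / ε * M := by
      have h := norm_exp_sub_exp_le (N := N) (a := ρ) (c := C / (ε * s) * M) (u := ε * s) (v := s)
        (by nlinarith) (fun t ht _ => (norm_mul_le _ _).trans (by
          have ht0 : 0 < t := hεs.trans_le ht
          gcongr
          exact (hC t ht0).trans (by gcongr)))
      refine h.trans ?_
      calc C / (ε * s) * M * (s - ε * s) ≤ C / (ε * s) * M * s := by gcongr; linarith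
        _ = C / ε * M := by field_simp
    have e3 : ‖(exp ((ε * s) • N) - exp ((0 : ℝ) • N)) * ρ‖ ≤ m / 2 := by
      have h := norm_exp_sub_exp_le (N := N) (a := ρ) (c := m * ((M + 1) / s)) (u := 0)
        (v := ε * s) hεs.le (fun t ht hts => by
          rw [mul_comm N, mul_assoc]
          refine (norm_mul_le _ _).trans ?_
          gcongr
          exact hm t ht (hts.trans (by nlinarith)))
      refine h.trans_eq ?_
      rw [sub_zero]
      calc m * ((M + 1) / s) * (ε * s) = m * (ε * (M + 1)) := by field_simp
        _ = m / 2 := by rw [hεM]; ring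
    have hsplit : exp (s • N) = exp (s • N) * (1 - ρ) +
        (exp (s • N) - exp ((ε * s) • N)) * ρ + ρ +
        (exp ((ε * s) • N) - exp ((0 : ℝ) • N)) * ρ := by
      rw [zero_smul, exp_zero]
      ring
    rw [hsplit]
    exact norm_add_le_of_le (norm_add_le_of_le (norm_add_le_of_le e1 e2) hρM) e3
  set a := C * M + C / ε * M + M with ha
  have ha0 : 0 ≤ a := by positivity
  refine ⟨max (2 * a) (Real.exp (s₀ * ‖N‖)), fun t ht => ?_⟩
  have hcont : Continuous fun u : ℝ => ‖exp (u • N)‖ :=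
    (continuous_iff_continuousAt.2 fun u => (hasDerivAt_exp_real_smul N u).continuousAt).norm
  -- At a maximum point `s` of the norm on `[0, t]` the norm itself serves as `m`, so the term `m /
  -- 2` is absorbed.
  obtain ⟨s, hs, hmax⟩ := (isCompact_Icc (a := 0) (b := t)).exists_isMaxOn
    ⟨0, Set.left_mem_Icc.2 ht⟩ hcont.continuousOn
  refine (hmax (Set.right_mem_Icc.2 ht)).trans ?_
  rcases le_total s₀ s with h | h
  · refine le_max_of_le_left ?_
    have := key s h ‖exp (s • N)‖ fun u hu hus => hmax ⟨hu, hus.trans hs.2⟩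
    linarith
  · refine le_max_of_le_right ((norm_exp_le_exp_norm _).trans (Real.exp_le_exp.2 ?_))
    rw [norm_smul, Real.norm_of_nonneg hs.1]
    gcongr

/-! ### From a bounded exponential to bounded powers -/

/-- Split the exponent into two halves and give each one factor `N`: two decays of order `-1/2`
multiply to one of order `-1`. -/
theorem norm_sq_mul_one_add_pow_le {N : A} {C : ℝ} (hC0 : 0 ≤ C)
    (hC : ∀ j : ℕ, ‖N * (1 + N) ^ j‖ ≤ C / √(j + 1)) (i : ℕ) :
    ‖N ^ 2 * (1 + N) ^ i‖ ≤ 2 * C ^ 2 / (i + 1) := by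
  have hi : (0 : ℝ) < i + 1 := by positivity
  have hhalf : ∀ b : ℕ, i ≤ 2 * b + 1 → ‖N * (1 + N) ^ b‖ ≤ C / √((i + 1) / 2) := by
    intro b hb
    refine (hC b).trans ?_
    have hb' : (i : ℝ) ≤ 2 * b + 1 := by exact_mod_cast hb
    have : 0 < √(((i : ℝ) + 1) / 2) := Real.sqrt_pos.2 (by positivity)
    gcongr
    linarith
  have hfac : N ^ 2 * (1 + N) ^ i = (N * (1 + N) ^ (i / 2)) * (N * (1 + N) ^ (i - i / 2)) := by
    have : i = i / 2 + (i - i / 2) := by omega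
    conv_lhs => rw [this, pow_add]
    ring
  rw [hfac]
  refine (norm_mul_le _ _).trans ?_
  have h1 := hhalf (i / 2) (by omega)
  have h2 := hhalf (i - i / 2) (by omega)
  refine (mul_le_mul h1 h2 (norm_nonneg _) ((norm_nonneg _).trans h1)).trans_eq ?_
  rw [div_mul_div_comm, Real.mul_self_sqrt (by positivity)]
  field_simp

theorem norm_sq_mul_exp_le {N : A} {C : ℝ} (hC0 : 0 ≤ C)
    (hC : ∀ j : ℕ, ‖N * (1 + N) ^ j‖ ≤ C / √(j + 1)) {t : ℝ} (ht : 0 < t) :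
    ‖N ^ 2 * exp (t • N)‖ ≤ 2 * C ^ 2 / t := by
  have h := norm_mul_exp_le_div_sqrt hC0 hC (half_pos ht)
  have hfac : N ^ 2 * exp (t • N) = (N * exp ((t / 2) • N)) * (N * exp ((t / 2) • N)) := by
    have : exp (t • N) = exp ((t / 2) • N) * exp ((t / 2) • N) := by
      rw [← exp_real_smul_add, add_halves]
    rw [this]
    ring
  rw [hfac]
  refine (norm_mul_le _ _).trans ?_
  refine (mul_le_mul h h (norm_nonneg _) ((norm_nonneg _).trans h)).trans_eq ?_
  rw [div_mul_div_comm, Real.mul_self_sqrt (by positivity)]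
  field_simp

/-- Tauberian theorem: if `exp (t N)` is bounded and `N (1 + N) ^ j` decays like `j ^ (-1/2)`,
then `1 + N` is power bounded. -/
theorem exists_norm_one_add_pow_le_of_norm_exp_le {N : A} {C K : ℝ} (hC0 : 0 ≤ C)
    (hC : ∀ j : ℕ, ‖N * (1 + N) ^ j‖ ≤ C / √(j + 1))
    (hK : ∀ t : ℝ, 0 ≤ t → ‖exp (t • N)‖ ≤ K) : ∃ L : ℝ, ∀ j : ℕ, ‖(1 + N) ^ j‖ ≤ L := by
  have hK0 : 0 ≤ K := (norm_nonneg _).trans (hK 0 le_rfl)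
  obtain ⟨g, hg, -⟩ := exists_exp_eq_one_add_add_sq_mul N
  set D := 2 * C ^ 2 with hD
  have hD0 : 0 ≤ D := by positivity
  set G := ‖g‖
  have hG0 : 0 ≤ G := norm_nonneg g
  have hpow : ∀ m : ℕ, exp N ^ m = exp ((m : ℝ) • N) := fun m => by
    have := exp_real_smul_nat_mul N m 1
    rw [mul_one, one_smul] at this
    exact this.symm
  -- The summand `4 D G` makes the inductive contribution `(4 D G / p) a` at most `a`; the summand
  -- `2` gives `n ≤ 2 (n - 1 - i)` whenever `p (i + 1) < n`.
  obtain ⟨p, hp⟩ := exists_nat_ge (4 * D * G + 2)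
  have hp0 : (0 : ℝ) < p := by nlinarith [mul_nonneg hD0 hG0]
  have hp2 : 2 ≤ p := by
    have : (2 : ℝ) ≤ p := by nlinarith [mul_nonneg hD0 hG0]
    exact_mod_cast this
  set a := K + K * D * G * p with ha
  have ha0 : 0 ≤ a := by positivity
  refine ⟨2 * a, fun n => ?_⟩
  induction n using Nat.strong_induction_on with
  | _ n ih =>
  rcases Nat.eq_zero_or_pos n with rfl | hn
  · have := hK 0 le_rfl
    rw [zero_smul, exp_zero] at this
    have h2 : K ≤ a := by rw [ha]; linarith [show 0 ≤ K * D * G * p by positivity]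
    rw [pow_zero]
    linarith
  have hn0 : (0 : ℝ) < n := by exact_mod_cast hn
  have htel := geom_sum₂_mul (1 + N) (exp N) n
  have hdiff : 1 + N - exp N = -(N ^ 2 * g) := by rw [hg]; ring
  have heq : (1 + N) ^ n = exp N ^ n -
      ∑ i ∈ Finset.range n, N ^ 2 * (1 + N) ^ i * exp N ^ (n - 1 - i) * g := by
    rw [hdiff] at htel
    have : ∑ i ∈ Finset.range n, N ^ 2 * (1 + N) ^ i * exp N ^ (n - 1 - i) * g =
        (∑ i ∈ Finset.range n, (1 + N) ^ i * exp N ^ (n - 1 - i)) * (N ^ 2 * g) := by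
      rw [Finset.sum_mul]
      exact Finset.sum_congr rfl fun i _ => by ring
    rw [this]
    linear_combination -htel
  -- The factor `N ^ 2` in the telescoped difference goes to whichever side has the long exponent.
  -- If `p (i + 1) ≥ n` it is paired with `(1 + N) ^ i`, and the exponential is bounded by `K`.
  -- Otherwise it is paired with the exponential, and the induction hypothesis bounds `(1 + N) ^ i`;
  -- there are at most `n / p` such indices.
  have hterm : ∀ i ∈ Finset.range n, ‖N ^ 2 * (1 + N) ^ i * exp N ^ (n - 1 - i) * g‖ ≤
      K * D * G * p / n + if i ∈ Finset.range (n / p) then 2 * D * G * (2 * a) / n else 0 := by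
    intro i hi
    rw [Finset.mem_range] at hi
    refine (norm_mul_le _ _).trans ?_
    by_cases hip : p * (i + 1) < n
    · have hmem : i ∈ Finset.range (n / p) := by
        rw [Finset.mem_range]
        have : i + 1 ≤ n / p := (Nat.le_div_iff_mul_le (by omega)).2 (by nlinarith)
        omega
      rw [if_pos hmem]
      have hm : n ≤ 2 * (n - 1 - i) := by
        have : 2 * (i + 1) ≤ p * (i + 1) := Nat.mul_le_mul_right _ hp2
        omega
      have hmR : (n : ℝ) ≤ 2 * ((n - 1 - i : ℕ) : ℝ) := by exact_mod_cast hm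
      have hm0 : (0 : ℝ) < ((n - 1 - i : ℕ) : ℝ) := by linarith
      have h1 : ‖N ^ 2 * exp N ^ (n - 1 - i)‖ ≤ D / (n / 2) := by
        rw [hpow]
        refine (norm_sq_mul_exp_le hC0 hC hm0).trans ?_
        gcongr
        linarith
      have h2 : ‖N ^ 2 * (1 + N) ^ i * exp N ^ (n - 1 - i)‖ ≤ 2 * a * (D / (n / 2)) := by
        rw [show N ^ 2 * (1 + N) ^ i * exp N ^ (n - 1 - i) =
          (1 + N) ^ i * (N ^ 2 * exp N ^ (n - 1 - i)) by ring]
        refine (norm_mul_le _ _).trans ?_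
        gcongr
        exact ih i hi
      have h3 : 0 ≤ K * D * G * p / n := by positivity
      calc _ ≤ 2 * a * (D / (n / 2)) * G := by gcongr
        _ = 2 * D * G * (2 * a) / n := by field_simp
        _ ≤ _ := by linarith
    · have h0 : (0 : ℝ) ≤ if i ∈ Finset.range (n / p) then 2 * D * G * (2 * a) / n else 0 := by
        split_ifs
        · positivity
        · exact le_rfl
      have hipR : (n : ℝ) ≤ p * (i + 1) := by exact_mod_cast not_lt.1 hip
      have h1 : ‖N ^ 2 * (1 + N) ^ i‖ ≤ D / (n / p) := by
        refine (norm_sq_mul_one_add_pow_le hC0 hC i).trans ?_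
        gcongr
        rwa [div_le_iff₀' hp0]
      have h2 : ‖exp N ^ (n - 1 - i)‖ ≤ K := by
        rw [hpow]
        exact hK _ (Nat.cast_nonneg _)
      calc _ ≤ ‖N ^ 2 * (1 + N) ^ i‖ * ‖exp N ^ (n - 1 - i)‖ * G := by
            gcongr
            exact norm_mul_le _ _
        _ ≤ D / (n / p) * K * G := by gcongr
        _ = K * D * G * p / n := by field_simp
        _ ≤ _ := by linarith
  have hsum : ‖∑ i ∈ Finset.range n, N ^ 2 * (1 + N) ^ i * exp N ^ (n - 1 - i) * g‖ ≤
      K * D * G * p + a := by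
    refine (norm_sum_le_of_le _ hterm).trans ?_
    rw [Finset.sum_add_distrib, Finset.sum_const, Finset.card_range, Finset.sum_ite_mem,
      Finset.inter_eq_right.2 (Finset.range_subset_range.2 (Nat.div_le_self n p)),
      Finset.sum_const, Finset.card_range, nsmul_eq_mul, nsmul_eq_mul]
    have h1 : (n : ℝ) * (K * D * G * p / n) = K * D * G * p := by field_simp
    have h2 : ((n / p : ℕ) : ℝ) * (2 * D * G * (2 * a) / n) ≤ a := by
      calc _ ≤ (n / p : ℝ) * (2 * D * G * (2 * a) / n) := by
            gcongr
            exact Nat.cast_div_le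
        _ = (4 * D * G) / p * a := by field_simp; ring
        _ ≤ 1 * a := by
            gcongr
            rw [div_le_one hp0]
            linarith
        _ = a := one_mul a
    linarith
  rw [heq]
  refine (norm_sub_le _ _).trans ?_
  have h1 : ‖exp N ^ n‖ ≤ K := by
    rw [hpow]
    exact hK _ (Nat.cast_nonneg _)
  linarith

/-! ### The Ritt condition -/

/-- With `λ = (s + 1) / s`, `1 - s N` equals `s (λ - (1 + N))`. A finite geometric sum of length `n`
expresses `λ ^ n R` through powers of `1 + N` and the remainder `s N (1 + N) ^ n R`, which the decay
makes small when `n` is comparable to `‖s‖`. -/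
theorem norm_inverse_le_of_norm_mul_one_add_pow_le {N : A} (hN : ∀ w : ℂ, IsUnit (1 - w • N))
    {C D : ℝ} (hC : ∀ j : ℕ, ‖(1 + N) ^ j‖ ≤ C) (hD0 : 0 ≤ D)
    (hD : ∀ j : ℕ, ‖N * (1 + N) ^ j‖ ≤ D / (j + 1)) {s : ℂ} (hs : -(1 / 2 : ℝ) < s.re) :
    ‖Ring.inverse (1 - s • N)‖ ≤ 2 * (C * (1 + 2 * D)) := by
  have hC1 : 1 ≤ C := by simpa using hC 0
  rcases eq_or_ne s 0 with rfl | hs0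
  · simp only [zero_smul, sub_zero, Ring.inverse_one, norm_one]
    nlinarith [mul_nonneg (zero_le_one.trans hC1) hD0]
  have hsn : 0 < ‖s‖ := norm_pos_iff.2 hs0
  set lam : ℂ := (s + 1) / s with hlam
  have hlam1 : 1 ≤ ‖lam‖ := by
    rw [hlam, norm_div, one_le_div hsn]
    exact (norm_lt_norm_add_one hs).le
  have hlam0 : lam ≠ 0 := norm_pos_iff.1 (zero_lt_one.trans_le hlam1)
  have hls : s * (lam - 1) = 1 := by rw [hlam]; field_simp; ring
  have hl1 : lam - 1 = s⁻¹ := eq_inv_of_mul_eq_one_right hls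
  -- The least length for which `‖s‖ D / (n + 1) ≤ 1/2` is guaranteed, while the geometric sum still
  -- has at most `2 D ‖s‖` terms to offset the factor `s⁻¹`.
  set n := ⌊2 * D * ‖s‖⌋₊ with hn
  have hn1 : 2 * D * ‖s‖ ≤ n + 1 := (Nat.lt_floor_add_one _).le
  have hn2 : (n : ℝ) ≤ 2 * D * ‖s‖ := Nat.floor_le (by positivity)
  set R := Ring.inverse (1 - s • N) with hR
  have hRinv : (1 - s • N) * R = 1 := Ring.mul_inverse_cancel _ (hN s)
  set q : A := ∑ i ∈ Finset.range n, (1 + N) ^ i * algebraMap ℂ A lam ^ (n - 1 - i) with hq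
  have hgeom := geom_sum₂_mul (1 + N) (algebraMap ℂ A lam) n
  have hqn : ‖q‖ ≤ n * (C * ‖lam‖ ^ n) := by
    rw [← nsmul_eq_mul, ← Finset.card_range n, ← Finset.sum_const]
    refine norm_sum_le_of_le _ fun i hi => (norm_mul_le _ _).trans ?_
    gcongr
    · exact hC i
    · rw [← map_pow, norm_algebraMap', norm_pow]
      exact pow_le_pow_right₀ hlam1 (by rw [Finset.card_range]; omega)
  have hid : (lam ^ n) • R = (1 + N) ^ n + (s⁻¹ : ℂ) • q + s • (N * (1 + N) ^ n * R) := by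
    rw [← hl1]
    have hls' : algebraMap ℂ A s * (algebraMap ℂ A lam - 1) = 1 := by
      rw [← map_one (algebraMap ℂ A), ← map_sub, ← map_mul, hls]
    simp only [Algebra.smul_def, map_sub, map_one, map_pow] at hRinv ⊢
    rw [← hq] at hgeom
    linear_combination ((1 + N) ^ n + (algebraMap ℂ A lam - 1) * q) * hRinv + R * hgeom +
      q * N * R * hls'
  have hNn : ‖s • (N * (1 + N) ^ n * R)‖ ≤ ‖lam‖ ^ n * ‖R‖ / 2 := by
    rw [norm_smul]
    have h1 : ‖s‖ * ‖N * (1 + N) ^ n‖ ≤ 1 / 2 := by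
      have hpos : (0 : ℝ) < n + 1 := by positivity
      calc _ ≤ ‖s‖ * (D / (n + 1)) := by gcongr; exact hD n
        _ ≤ 1 / 2 := by
            rw [← mul_div_assoc, div_le_iff₀ hpos]
            linarith
    calc _ ≤ ‖s‖ * (‖N * (1 + N) ^ n‖ * ‖R‖) := by gcongr; exact norm_mul_le _ _
      _ = (‖s‖ * ‖N * (1 + N) ^ n‖) * ‖R‖ := by ring
      _ ≤ 1 / 2 * ‖R‖ := by gcongr
      _ ≤ 1 / 2 * (‖lam‖ ^ n * ‖R‖) := by
          gcongr
          exact le_mul_of_one_le_left (norm_nonneg _) (one_le_pow₀ hlam1)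
      _ = _ := by ring
  have hln : 1 ≤ ‖lam‖ ^ n := one_le_pow₀ hlam1
  have hq2 : ‖(s⁻¹ : ℂ) • q‖ ≤ 2 * D * (C * ‖lam‖ ^ n) := by
    rw [norm_smul, norm_inv]
    calc _ ≤ ‖s‖⁻¹ * (2 * D * ‖s‖ * (C * ‖lam‖ ^ n)) := by
          gcongr
          exact hqn.trans (by gcongr)
      _ = _ := by field_simp
  have h := norm_add_le_of_le (norm_add_le_of_le (hC n) hq2) hNn
  rw [← hid, norm_smul, norm_pow] at h
  have h2 : C ≤ C * ‖lam‖ ^ n := le_mul_of_one_le_right (by linarith) hln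
  refine le_of_mul_le_mul_left ?_ (zero_lt_one.trans_le hln)
  nlinarith

end CommutativeAlgebra

/-- On the circle, `(1 - r ^ 2) / ‖1 - z‖ ^ 2` is the real part of `(1 + z) / (1 - z)`, and the mean
value property evaluates its average at the origin. -/
theorem circleAverage_inv_norm_one_sub_sq {r : ℝ} (hr0 : 0 < r) (hr1 : r < 1) :
    Real.circleAverage (fun z : ℂ => (‖1 - z‖ ^ 2)⁻¹) 0 r = (1 - r ^ 2)⁻¹ := by
  have hne : ∀ z ∈ Metric.closedBall (0 : ℂ) r, 1 - z ≠ 0 := by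
    intro z hz h
    rw [mem_closedBall_zero_iff, ← sub_eq_zero.1 h, norm_one] at hz
    linarith
  have hd : DifferentiableOn ℂ (fun z : ℂ => (1 + z) / (1 - z)) (Metric.closedBall 0 r) := by
    fun_prop (disch := assumption)
  have hav : Real.circleAverage (fun z : ℂ => (1 + z) / (1 - z)) 0 r = 1 := by
    have h := DiffContOnCl.circleAverage (f := fun z : ℂ => (1 + z) / (1 - z)) (c := 0) (R := r)
      (by
        rw [abs_of_pos hr0]
        exact (hd.mono Metric.closure_ball_subset_closedBall).diffContOnCl)
    simpa using h
  have hint : CircleIntegrable (fun z : ℂ => (1 + z) / (1 - z)) 0 r :=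
    (hd.continuousOn.mono Metric.sphere_subset_closedBall).circleIntegrable hr0.le
  have hre := Complex.reCLM.circleAverage_comp_comm hint
  rw [hav, Complex.reCLM_apply, Complex.one_re] at hre
  have hr2 : 0 < 1 - r ^ 2 := by nlinarith
  have hcongr : Real.circleAverage (Complex.reCLM ∘ fun z : ℂ => (1 + z) / (1 - z)) 0 r =
      Real.circleAverage (fun z : ℂ => (1 - r ^ 2) • (‖1 - z‖ ^ 2)⁻¹) 0 r := by
    refine Real.circleAverage_congr_sphere fun z hz => ?_
    rw [abs_of_pos hr0, mem_sphere_zero_iff_norm] at hz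
    have h2 : z.re * z.re + z.im * z.im = r ^ 2 := by
      rw [← Complex.normSq_apply, Complex.normSq_eq_norm_sq, hz]
    simp only [Function.comp_apply, Complex.reCLM_apply, Complex.div_re,
      Complex.normSq_eq_norm_sq, Complex.add_re, Complex.add_im, Complex.sub_re, Complex.sub_im,
      Complex.one_re, Complex.one_im, smul_eq_mul]
    rw [← h2]
    ring
  rw [hcongr, Real.circleAverage_fun_smul, smul_eq_mul] at hre
  exact eq_inv_of_mul_eq_one_right hre

/-- Cauchy estimate at the origin for functions bounded by a multiple of `‖1 - z‖ ^ (-2)`. -/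
theorem norm_iteratedDeriv_le_of_norm_le_div_norm_one_sub_sq {E : Type*} [NormedAddCommGroup E]
    [NormedSpace ℂ E] [CompleteSpace E] {f : ℂ → E} {r B : ℝ} (hr0 : 0 < r) (hr1 : r < 1)
    (hf : DifferentiableOn ℂ f (Metric.closedBall 0 r))
    (hB : ∀ z : ℂ, ‖z‖ = r → ‖f z‖ ≤ B * (‖1 - z‖ ^ 2)⁻¹) (k : ℕ) :
    ‖iteratedDeriv k f 0‖ ≤ k.factorial * (B * (1 - r ^ 2)⁻¹ / r ^ k) := by
  have h := hf.circleIntegral_one_div_sub_center_pow_smul hr0 k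
  have hpi : (0 : ℝ) < 2 * Real.pi := by positivity
  have hav := circleAverage_inv_norm_one_sub_sq hr0 hr1
  rw [Real.circleAverage_def, smul_eq_mul] at hav
  have hint : IntervalIntegrable (fun θ : ℝ => B / r ^ k * (‖1 - circleMap 0 r θ‖ ^ 2)⁻¹)
      MeasureTheory.volume 0 (2 * Real.pi) := by
    refine Continuous.intervalIntegrable ?_ _ _
    refine continuous_const.mul (Continuous.inv₀ (by fun_prop) fun θ => ?_)
    have : 1 - circleMap 0 r θ ≠ 0 := by
      intro h0
      have h1 := norm_circleMap_zero r θ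
      rw [← sub_eq_zero.1 h0, norm_one, abs_of_pos hr0] at h1
      linarith
    positivity
  have hle : ‖∮ z in C(0, r), (1 / (z - 0) ^ (k + 1)) • f z‖ ≤
      ∫ θ in (0 : ℝ)..2 * Real.pi, B / r ^ k * (‖1 - circleMap 0 r θ‖ ^ 2)⁻¹ := by
    refine intervalIntegral.norm_integral_le_of_norm_le hpi.le (Eventually.of_forall ?_) hint
    intro θ _
    have hn : ‖circleMap 0 r θ‖ = r := by rw [norm_circleMap_zero, abs_of_pos hr0]
    rw [norm_smul, norm_smul, deriv_circleMap, norm_mul, Complex.norm_I, mul_one, sub_zero,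
      norm_div, norm_one, norm_pow, hn]
    calc r * (1 / r ^ (k + 1) * ‖f (circleMap 0 r θ)‖)
        ≤ r * (1 / r ^ (k + 1) * (B * (‖1 - circleMap 0 r θ‖ ^ 2)⁻¹)) := by
          gcongr
          exact hB _ hn
      _ = _ := by rw [pow_succ]; field_simp
  rw [intervalIntegral.integral_const_mul] at hle
  rw [h, norm_smul, norm_div, Complex.norm_natCast] at hle
  have h2pi : ‖(2 * Real.pi * Complex.I : ℂ)‖ = 2 * Real.pi := by
    simp [abs_of_pos Real.pi_pos]
  rw [h2pi] at hle
  have hI : ∫ θ in (0 : ℝ)..2 * Real.pi, (‖1 - circleMap 0 r θ‖ ^ 2)⁻¹ =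
      2 * Real.pi * (1 - r ^ 2)⁻¹ := by
    rw [← hav]
    field_simp
  rw [hI] at hle
  have hk : (0 : ℝ) < k.factorial := by exact_mod_cast k.factorial_pos
  have hmul : 2 * Real.pi * ‖iteratedDeriv k f 0‖ ≤
      2 * Real.pi * (k.factorial * (B * (1 - r ^ 2)⁻¹ / r ^ k)) := by
    have := mul_le_mul_of_nonneg_left hle hk.le
    calc _ = k.factorial * (2 * Real.pi / k.factorial * ‖iteratedDeriv k f 0‖) := by field_simp
      _ ≤ _ := this
      _ = _ := by field_simp
  exact le_of_mul_le_mul_left hmul hpi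

section CommutativeAlgebra

variable {A : Type*} [NormedCommRing A] [NormedAlgebra ℂ A] [CompleteSpace A] [NormOneClass A]

/-- The substitution `s = z / (1 - z)`, which carries the unit disc to `Re s > -1/2`, translates
between resolvents of `1 + N` and of `N`. -/
theorem one_sub_smul_one_add {N : A} {z : ℂ} (hz : z ≠ 1) :
    1 - z • (1 + N) = (1 - z) • (1 - (z / (1 - z)) • N) := by
  have : 1 - z ≠ 0 := sub_ne_zero.2 hz.symm
  rw [smul_sub, smul_smul, mul_div_cancel₀ _ this]
  module

theorem isUnit_one_sub_smul_one_add {N : A} (hN : ∀ w : ℂ, IsUnit (1 - w • N)) {z : ℂ}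
    (hz : z ≠ 1) : IsUnit (1 - z • (1 + N)) := by
  rw [one_sub_smul_one_add hz]
  have := (hN (z / (1 - z))).smul (Units.mk0 (1 - z) (sub_ne_zero.2 hz.symm))
  simpa [Units.smul_def] using this

theorem neg_half_lt_re_div_one_sub {z : ℂ} (hz : ‖z‖ < 1) : -(1 / 2 : ℝ) < (z / (1 - z)).re := by
  have hz1 : 1 - z ≠ 0 := by
    intro h
    rw [← sub_eq_zero.1 h, norm_one] at hz
    exact lt_irrefl _ hz
  have hpos : 0 < Complex.normSq (1 - z) := Complex.normSq_pos.2 hz1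
  have h2 : z.re * z.re + z.im * z.im < 1 := by
    rw [← Complex.normSq_apply, Complex.normSq_eq_norm_sq]
    exact pow_lt_one₀ (norm_nonneg _) hz two_ne_zero
  rw [Complex.div_re, ← add_div, lt_div_iff₀ hpos, Complex.normSq_apply]
  simp only [Complex.sub_re, Complex.sub_im, Complex.one_re, Complex.one_im]
  nlinarith

/-- The cube supplies a coefficient of order `k ^ 2` beyond `k!`. The Cauchy estimate loses one
power of `k`, so a decay of order `1/k` remains. -/
theorem iteratedDeriv_mul_inverse_one_sub_smul_pow {B : A} (a : A)
    (hB : ∀ z ∈ Metric.ball (0 : ℂ) 1, IsUnit (1 - z • B)) (k : ℕ) :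
    Set.EqOn (iteratedDeriv k fun z : ℂ => a * Ring.inverse (1 - z • B) ^ 3)
      (fun z => (((k + 2).factorial : A) * algebraMap ℂ A 2⁻¹) * a * B ^ k *
        Ring.inverse (1 - z • B) ^ (k + 3)) (Metric.ball 0 1) := by
  induction k with
  | zero =>
    intro z _
    have h2 : (2 : A) * algebraMap ℂ A 2⁻¹ = 1 := by
      rw [← map_ofNat (algebraMap ℂ A) 2, ← map_mul]; simp
    simp [h2]
  | succ k ih =>
    intro z hz
    rw [iteratedDeriv_succ]
    have heq := ih.eventuallyEq_of_mem (Metric.isOpen_ball.mem_nhds hz)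
    rw [heq.deriv_eq]
    have h := ((hasDerivAt_inverse_one_sub_smul (hB z hz)).pow (k + 3)).const_mul
      ((((k + 2).factorial : A) * algebraMap ℂ A 2⁻¹) * a * B ^ k)
    refine h.deriv.trans ?_
    rw [show (k + 1 + 2).factorial = (k + 3) * (k + 2).factorial from Nat.factorial_succ _]
    push_cast
    ring

/-- The Ritt condition implies that `j N (1 + N) ^ j` is bounded. -/
theorem norm_mul_one_add_pow_le_of_norm_inverse_le {N : A} (hN : ∀ w : ℂ, IsUnit (1 - w • N))
    {M : ℝ} (hM : ∀ s : ℂ, -(1 / 2 : ℝ) < s.re → ‖Ring.inverse (1 - s • N)‖ ≤ M) (k : ℕ) :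
    ‖N * (1 + N) ^ k‖ ≤ 4 * Real.exp 1 * (M + 1) * M ^ 2 / (k + 1) := by
  have hM0 : 0 ≤ M := (norm_nonneg _).trans (hM 0 (by norm_num))
  have hne : ∀ {z : ℂ}, ‖z‖ < 1 → z ≠ 1 := by
    rintro z hz rfl
    simp at hz
  set V : ℂ → A := fun z => Ring.inverse (1 - z • (1 + N)) with hV
  have hunit : ∀ {z : ℂ}, ‖z‖ < 1 → IsUnit (1 - z • (1 + N)) := fun hz =>
    isUnit_one_sub_smul_one_add hN (hne hz)
  have hVn : ∀ {z : ℂ}, ‖z‖ < 1 → ‖V z‖ ≤ M * ‖1 - z‖⁻¹ := by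
    intro z hz
    have hz0 : 1 - z ≠ 0 := sub_ne_zero.2 (hne hz).symm
    have : V z = (1 - z)⁻¹ • Ring.inverse (1 - (z / (1 - z)) • N) := by
      have h := eq_inverse_mul (a := 1) (c := (1 - z)⁻¹ • Ring.inverse (1 - (z / (1 - z)) • N))
        (hunit hz) (by
          rw [one_sub_smul_one_add (hne hz), smul_mul_smul_comm, mul_inv_cancel₀ hz0,
            Ring.mul_inverse_cancel _ (hN _), one_smul])
      rw [h, mul_one]
    rw [this, norm_smul, norm_inv, mul_comm]
    gcongr
    exact hM _ (neg_half_lt_re_div_one_sub hz)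
  -- At this radius `(1 - r ^ 2)⁻¹ ≤ k + 2` and `r ^ (-k) ≤ e`; also `r ≥ 1/2`, which is needed to
  -- divide by `‖z‖` below.
  set r : ℝ := (k + 1) / (k + 2) with hr
  have hk1 : (0 : ℝ) < k + 1 := by positivity
  have hk2 : (0 : ℝ) < k + 2 := by positivity
  have hr0 : 0 < r := by positivity
  have hr1 : r < 1 := by rw [hr, div_lt_one hk2]; linarith
  have hrhalf : 1 / 2 ≤ r := by
    rw [hr, div_le_div_iff₀ two_pos hk2]
    linarith [k.cast_nonneg (α := ℝ)]
  have hball : ∀ z ∈ Metric.closedBall (0 : ℂ) r, ‖z‖ < 1 := fun z hz =>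
    (mem_closedBall_zero_iff.1 hz).trans_lt hr1
  have hf : DifferentiableOn ℂ (fun z => N * V z ^ 3) (Metric.closedBall 0 r) := fun z hz =>
    (((hasDerivAt_inverse_one_sub_smul (hunit (hball z hz))).pow 3).const_mul
      N).differentiableAt.differentiableWithinAt
  -- One factor `V` is spent on `N V`, which stays bounded because `z N V = (1 - z) V - 1`; only the
  -- other two contribute `‖1 - z‖⁻¹` each.
  have hB : ∀ z : ℂ, ‖z‖ = r → ‖N * V z ^ 3‖ ≤ 2 * (M + 1) * M ^ 2 * (‖1 - z‖ ^ 2)⁻¹ := by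
    intro z hz
    have hz1 : ‖z‖ < 1 := hz.trans_lt hr1
    have hz0 : 0 < ‖1 - z‖ := norm_pos_iff.2 (sub_ne_zero.2 (hne hz1).symm)
    have hid : z • (N * V z) = (1 - z) • V z - 1 := by
      have := Ring.inverse_mul_cancel _ (hunit hz1)
      change V z * _ = 1 at this
      simp only [Algebra.smul_def, map_sub, map_one] at this ⊢
      linear_combination -this
    have hNV : ‖N * V z‖ ≤ 2 * (M + 1) := by
      have h1 : ‖z‖ * ‖N * V z‖ ≤ M + 1 := by
        rw [← norm_smul, hid]
        refine (norm_sub_le _ _).trans ?_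
        rw [norm_one, norm_smul]
        gcongr
        calc _ ≤ ‖1 - z‖ * (M * ‖1 - z‖⁻¹) := by gcongr; exact hVn hz1
          _ = M := by field_simp
      rw [hz] at h1
      nlinarith [norm_nonneg (N * V z)]
    rw [show N * V z ^ 3 = N * V z * V z ^ 2 by ring]
    refine (norm_mul_le _ _).trans ?_
    calc _ ≤ 2 * (M + 1) * (M * ‖1 - z‖⁻¹) ^ 2 := by
          gcongr
          exact (norm_pow_le _ _).trans (pow_le_pow_left₀ (norm_nonneg _) (hVn hz1) 2)
      _ = _ := by rw [mul_pow, inv_pow]; ring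
  have hmain := norm_iteratedDeriv_le_of_norm_le_div_norm_one_sub_sq hr0 hr1 hf hB k
  rw [iteratedDeriv_mul_inverse_one_sub_smul_pow N
    (fun z hz => hunit (mem_ball_zero_iff.1 hz)) k (Metric.mem_ball_self one_pos)] at hmain
  have hval : ((((k + 2).factorial : A) * algebraMap ℂ A 2⁻¹) * N * (1 + N) ^ k *
      Ring.inverse (1 - (0 : ℂ) • (1 + N)) ^ (k + 3)) =
      (((k + 2).factorial : ℂ) * 2⁻¹) • (N * (1 + N) ^ k) := by
    rw [zero_smul, sub_zero, Ring.inverse_one, one_pow, mul_one, Algebra.smul_def, map_mul,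
      map_natCast]
    ring
  beta_reduce at hmain
  rw [hval, norm_smul, norm_mul, Complex.norm_natCast, norm_inv, Complex.norm_ofNat,
    Nat.factorial_succ, Nat.factorial_succ] at hmain
  push_cast at hmain
  have hkf : (0 : ℝ) < k.factorial := by exact_mod_cast k.factorial_pos
  have hr2 : (1 - r ^ 2)⁻¹ ≤ (k : ℝ) + 2 := by
    rw [inv_le_comm₀ (by nlinarith) hk2]
    have : 1 - r = (k + 2 : ℝ)⁻¹ := by rw [hr]; field_simp; ring
    rw [← this]
    nlinarith
  have hrk : (r ^ k)⁻¹ ≤ Real.exp 1 := by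
    have h1 : r⁻¹ ≤ Real.exp (1 / (k + 1)) := by
      have : r⁻¹ = 1 / (k + 1) + 1 := by rw [hr]; field_simp; ring
      rw [this]
      exact Real.add_one_le_exp _
    calc (r ^ k)⁻¹ = r⁻¹ ^ k := (inv_pow r k).symm
      _ ≤ Real.exp (1 / (k + 1)) ^ k := pow_le_pow_left₀ (by positivity) h1 k
      _ = Real.exp (k * (1 / (k + 1))) := (Real.exp_nat_mul _ _).symm
      _ ≤ Real.exp 1 := by
          refine Real.exp_le_exp.2 ?_
          rw [mul_one_div, div_le_one hk1]
          linarith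
  have hbound : 2 * (M + 1) * M ^ 2 * (1 - r ^ 2)⁻¹ / r ^ k ≤
      2 * (M + 1) * M ^ 2 * (k + 2) * Real.exp 1 := by
    rw [div_eq_mul_inv]
    gcongr
  have h3 := hmain.trans (mul_le_mul_of_nonneg_left hbound hkf.le)
  rw [le_div_iff₀ hk1]
  have hpos : (0 : ℝ) < k.factorial * (k + 2) / 2 := by positivity
  refine le_of_mul_le_mul_left ?_ hpos
  calc _ = ((k : ℝ) + 1 + 1) * ((k + 1) * k.factorial) * 2⁻¹ * ‖N * (1 + N) ^ k‖ := by ring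
    _ ≤ _ := h3
    _ = _ := by ring

/-- The Ritt condition extends to larger half-planes. -/
theorem exists_norm_inverse_le_of_neg_lt_re {N : A} (hN : ∀ w : ℂ, IsUnit (1 - w • N))
    {M : ℝ} (hM : ∀ s : ℂ, -(1 / 2 : ℝ) < s.re → ‖Ring.inverse (1 - s • N)‖ ≤ M) {r : ℝ}
    (hr : 0 < r) : ∃ M' : ℝ, ∀ s : ℂ, -r < s.re → ‖Ring.inverse (1 - s • N)‖ ≤ M' := by
  have hM0 : 0 ≤ M := (norm_nonneg _).trans (hM 0 (by norm_num))
  -- For `|Im s| > l`, compare `s` with its projection `w` to the imaginary axis. There `‖N S‖ ≤ (M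
  -- + 1) / l`, so the correction in the resolvent identity is at most `‖R‖ / 2`. The remaining
  -- points of the strip lie in a compact ball.
  set l := 2 * r * (M + 1) with hl
  have hl0 : 0 < l := by positivity
  have hcont : Continuous fun w : ℂ => Ring.inverse (1 - w • N) :=
    continuous_iff_continuousAt.2 fun w => (hasDerivAt_inverse_one_sub_smul (hN w)).continuousAt
  obtain ⟨P, hP⟩ := (isCompact_closedBall (0 : ℂ) (r + l)).exists_bound_of_continuousOn
    hcont.continuousOn
  refine ⟨max P (2 * M), fun s hs => ?_⟩
  rcases lt_or_ge (-(1 / 2 : ℝ)) s.re with h | h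
  · exact (hM s h).trans (le_max_of_le_right (by linarith))
  rcases le_or_gt |s.im| l with hi | hi
  · refine (hP s ?_).trans (le_max_left _ _)
    rw [mem_closedBall_zero_iff]
    refine (Complex.norm_le_abs_re_add_abs_im s).trans (add_le_add ?_ hi)
    rw [abs_of_nonpos (by linarith)]
    linarith
  refine le_max_of_le_right ?_
  set w : ℂ := s.im * Complex.I with hw
  have hwn : ‖w‖ = |s.im| := by simp [hw]
  have hw0 : 0 < ‖w‖ := by rw [hwn]; linarith
  have hRw := hM w (by simp [hw])
  set R := Ring.inverse (1 - s • N) with hR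
  set S := Ring.inverse (1 - w • N) with hS
  have hRinv : R * (1 - s • N) = 1 := Ring.inverse_mul_cancel _ (hN s)
  have hSinv : S * (1 - w • N) = 1 := Ring.inverse_mul_cancel _ (hN w)
  have hid : R = S + (s - w) • (N * S * R) := by
    simp only [Algebra.smul_def, map_sub] at hRinv hSinv ⊢
    linear_combination S * hRinv - R * hSinv
  have hNS : ‖N * S‖ ≤ (M + 1) / l := by
    have h1 : ‖w‖ * ‖N * S‖ ≤ M + 1 := by
      rw [← norm_smul]
      have : w • (N * S) = S - 1 := by
        simp only [Algebra.smul_def] at hSinv ⊢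
        linear_combination -hSinv
      rw [this]
      exact (norm_sub_le _ _).trans (by rw [norm_one]; gcongr)
    rw [le_div_iff₀' hl0]
    refine le_trans ?_ h1
    rw [hwn]
    gcongr
  have hsw : ‖s - w‖ ≤ r := by
    have : s - w = (s.re : ℂ) := by
      rw [hw, sub_eq_iff_eq_add]
      exact (Complex.re_add_im s).symm
    rw [this, Complex.norm_real, Real.norm_eq_abs, abs_of_nonpos (by linarith)]
    linarith
  have h2 : ‖(s - w) • (N * S * R)‖ ≤ ‖R‖ / 2 := by
    rw [norm_smul]
    calc _ ≤ r * ((M + 1) / l * ‖R‖) := by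
          gcongr
          exact (norm_mul_le _ _).trans (by gcongr)
      _ = ‖R‖ / 2 := by rw [hl]; field_simp
  have h3 : ‖R‖ ≤ M + ‖R‖ / 2 := by
    conv_lhs => rw [hid]
    exact norm_add_le_of_le hRw h2
  linarith

end CommutativeAlgebra

-- Transfer to a commutative algebra

universe u

section Transfer

variable {X : Type u} [NormedAddCommGroup X] [NormedSpace ℂ X]

/-- A bounded operator lies in a commutative Banach algebra of operators in which all the
resolvents that exist in the algebra of all bounded operators exist as well, namely its
bicommutant. -/
theorem exists_commutative_banach_algebra [CompleteSpace X] [Nontrivial X] (Q : X →L[ℂ] X) :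
    ∃ (A : Type u) (_ : NormedCommRing A) (_ : NormedAlgebra ℂ A) (_ : CompleteSpace A)
      (_ : NormOneClass A) (φ : A →ₐ[ℂ] (X →L[ℂ] X)) (q : A), (∀ a, ‖φ a‖ = ‖a‖) ∧ φ q = Q ∧
        ∀ a : A, IsUnit (φ a) → IsUnit a := by
  set S : Subalgebra ℂ (X →L[ℂ] X) := Subalgebra.centralizer ℂ (Set.centralizer {Q}) with hS
  have hQ : Q ∈ Set.centralizer {Q} := by
    intro a ha
    rw [Set.mem_singleton_iff.1 ha]
  -- Since `Q` commutes with itself, the bicommutant lies in the commutant; this is what makes it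
  -- commutative.
  have hsub : ∀ a ∈ S, a ∈ Set.centralizer {Q} := by
    intro a ha b hb
    rw [Set.mem_singleton_iff.1 hb]
    exact (Subalgebra.mem_centralizer_iff ℂ).1 ha Q hQ
  have hcomm : ∀ a b : S, a * b = b * a := fun a b =>
    Subtype.ext ((Subalgebra.mem_centralizer_iff ℂ).1 b.2 a (hsub a a.2))
  have hcl : IsClosed (S : Set (X →L[ℂ] X)) := Set.isClosed_centralizer _
  refine ⟨S, { Subalgebra.normedRing S with mul_comm := hcomm }, Subalgebra.toNormedAlgebra S,
    hcl.completeSpace_coe, ⟨norm_one (α := X →L[ℂ] X)⟩, S.val, ⟨Q, ?_⟩, fun _ => rfl, rfl, ?_⟩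
  · exact (Subalgebra.mem_centralizer_iff ℂ).2 fun b hb => (hb Q rfl).symm
  · rintro a ⟨v, hv⟩
    have hmem : (↑v⁻¹ : X →L[ℂ] X) ∈ S := by
      refine (Subalgebra.mem_centralizer_iff ℂ).2 fun b hb => ?_
      have h : Commute b ↑v := by
        rw [hv]
        exact (Subalgebra.mem_centralizer_iff ℂ).1 a.2 b hb
      exact h.units_inv_right
    refine ⟨⟨a, ⟨_, hmem⟩, Subtype.ext ?_, Subtype.ext ?_⟩, rfl⟩
    · change S.val a * ↑v⁻¹ = 1
      rw [← hv, Units.mul_inv]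
    · change ↑v⁻¹ * S.val a = 1
      rw [← hv, Units.inv_mul]

theorem isUnit_one_sub_smul_of_spectrum_eq {Q : X →L[ℂ] X} (hQ : spectrum ℂ Q = {0}) (w : ℂ) :
    IsUnit (1 - w • Q) := by
  rcases eq_or_ne w 0 with rfl | hw
  · simp
  have h : w⁻¹ ∉ spectrum ℂ Q := by simp [hQ, hw]
  rw [spectrum.notMem_iff] at h
  have h2 := h.smul (Units.mk0 w hw)
  rwa [Units.smul_def, Units.val_mk0, smul_sub, Algebra.algebraMap_eq_smul_one, smul_smul,
    mul_inv_cancel₀ hw, one_smul] at h2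

variable {A : Type*} [NormedCommRing A] [NormedAlgebra ℂ A] [CompleteSpace A] [NormOneClass A]
  {φ : A →ₐ[ℂ] (X →L[ℂ] X)} {q : A}

theorem norm_one_add_smul_pow_eq (hφ : ∀ a, ‖φ a‖ = ‖a‖) (z : ℂ) (j : ℕ) :
    ‖(1 + z • φ q) ^ j‖ = ‖(1 + z • q) ^ j‖ := by
  rw [← hφ]
  simp

theorem map_inverse_eq {a : A} (ha : IsUnit a) : φ (Ring.inverse a) = Ring.inverse (φ a) := by
  obtain ⟨v, rfl⟩ := ha
  rw [Ring.inverse_unit]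
  exact (Ring.inverse_unit (Units.map (φ : A →* (X →L[ℂ] X)) v)).symm

theorem norm_res_pow_eq (hφ : ∀ a, ‖φ a‖ = ‖a‖) (hq : ∀ w : ℂ, IsUnit (1 - w • q)) (s z : ℂ)
    (k : ℕ) : ‖res (φ q) (s * z) ^ k‖ = ‖Ring.inverse (1 - s • (z • q)) ^ k‖ := by
  rw [← hφ, map_pow, map_inverse_eq (by rw [smul_smul]; exact hq _), res]
  simp [smul_smul]

theorem norm_res_eq (hφ : ∀ a, ‖φ a‖ = ‖a‖) (hq : ∀ w : ℂ, IsUnit (1 - w • q)) (s z : ℂ) :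
    ‖res (φ q) (s * z)‖ = ‖Ring.inverse (1 - s • (z • q))‖ := by
  simpa using norm_res_pow_eq hφ hq s z 1

theorem norm_exp_smul_eq [CompleteSpace X] (hφ : ∀ a, ‖φ a‖ = ‖a‖) (t : ℝ) (z : ℂ) :
    ‖exp (((t : ℂ) * z) • φ q)‖ = ‖exp (t • (z • q))‖ := by
  let _ : NormedAlgebra ℚ A := NormedAlgebra.restrictScalars ℚ ℂ A
  let _ : NormedAlgebra ℚ (X →L[ℂ] X) := NormedAlgebra.restrictScalars ℚ ℂ (X →L[ℂ] X)
  have hc : Continuous φ := (AddMonoidHomClass.isometry_of_norm φ hφ).continuous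
  rw [← hφ, map_exp φ hc, ← Complex.coe_smul, smul_smul, map_smul]

theorem mem_powerBoundedSet_iff (hφ : ∀ a, ‖φ a‖ = ‖a‖) {z : ℂ} :
    z ∈ powerBoundedSet (φ q) ↔ ∃ C : ℝ, ∀ j : ℕ, ‖(1 + z • q) ^ j‖ ≤ C := by
  simp only [powerBoundedSet, Set.mem_ofPred_eq, norm_one_add_smul_pow_eq hφ]
  refine ⟨fun ⟨C, hC⟩ => ⟨max C 1, fun j => ?_⟩, fun ⟨C, hC⟩ => ⟨C, fun j _ => hC j⟩⟩
  rcases Nat.eq_zero_or_pos j with rfl | hj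
  · simp
  · exact (hC j hj).trans (le_max_left _ _)

theorem mem_abelSet_iff (hφ : ∀ a, ‖φ a‖ = ‖a‖) (hq : ∀ w : ℂ, IsUnit (1 - w • q)) {k : ℕ}
    {z : ℂ} : z ∈ abelSet (φ q) k ↔ ∃ M s₀ : ℝ, 0 < s₀ ∧ ∀ s : ℝ, s₀ ≤ s →
      ‖Ring.inverse (1 - (s : ℂ) • (z • q)) ^ k‖ ≤ M := by
  simp only [abelSet, Set.mem_ofPred_eq, norm_res_pow_eq hφ hq, IsBoundedUnder, IsBounded,
    eventually_map, eventually_atTop]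
  refine ⟨fun ⟨M, s₀, h⟩ => ⟨M, max s₀ 1, by positivity, fun s hs =>
    h s ((le_max_left _ _).trans hs)⟩, fun ⟨M, s₀, _, h⟩ => ⟨M, s₀, h⟩⟩

theorem mem_hilleYosidaSet_iff [CompleteSpace X] (hφ : ∀ a, ‖φ a‖ = ‖a‖) {z : ℂ} :
    z ∈ hilleYosidaSet (φ q) ↔ ∃ K : ℝ, ∀ t : ℝ, 0 ≤ t → ‖exp (t • (z • q))‖ ≤ K := by
  simp only [hilleYosidaSet, Set.mem_ofPred_eq, norm_exp_smul_eq hφ, IsBoundedUnder, IsBounded,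
    eventually_map, eventually_atTop]
  refine ⟨fun ⟨K, t₀, h⟩ => ⟨max K (Real.exp (t₀ * ‖z • q‖)), fun t ht => ?_⟩,
    fun ⟨K, h⟩ => ⟨K, 0, h⟩⟩
  rcases le_total t₀ t with h' | h'
  · exact (h t h').trans (le_max_left _ _)
  · refine ((norm_exp_le_exp_norm _).trans (Real.exp_le_exp.2 ?_)).trans (le_max_right _ _)
    rw [norm_smul, Real.norm_of_nonneg ht]
    gcongr

theorem mem_kreissSet_iff (hφ : ∀ a, ‖φ a‖ = ‖a‖) (hq : ∀ w : ℂ, IsUnit (1 - w • q)) {z : ℂ} :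
    z ∈ kreissSet (φ q) ↔ ∃ M : ℝ, ∀ s : ℂ, -(1 / 2 : ℝ) < s.re →
      (‖s + 1‖ - ‖s‖) * ‖Ring.inverse (1 - s • (z • q))‖ ≤ M := by
  simp only [kreissSet, Set.mem_ofPred_eq, norm_res_eq hφ hq]

theorem mem_iteratedKreissSet_iff (hφ : ∀ a, ‖φ a‖ = ‖a‖) (hq : ∀ w : ℂ, IsUnit (1 - w • q))
    {z : ℂ} : z ∈ iteratedKreissSet (φ q) ↔ ∃ M : ℝ, ∀ s : ℂ, -(1 / 2 : ℝ) < s.re →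
      ∀ k : ℕ, 1 ≤ k →
        (‖s + 1‖ - ‖s‖) ^ k * ‖Ring.inverse (1 - s • (z • q)) ^ k‖ ≤ M := by
  simp only [iteratedKreissSet, Set.mem_ofPred_eq, norm_res_pow_eq hφ hq]

theorem mem_rittSet_iff (hφ : ∀ a, ‖φ a‖ = ‖a‖) (hq : ∀ w : ℂ, IsUnit (1 - w • q)) {z : ℂ} :
    z ∈ rittSet (φ q) ↔ ∃ M : ℝ, ∀ s : ℂ, -(1 / 2 : ℝ) < s.re →
      ‖Ring.inverse (1 - s • (z • q))‖ ≤ M := by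
  simp only [rittSet, Set.mem_ofPred_eq, norm_res_eq hφ hq]

/-- A sequence that is eventually bounded is bounded, so the upper limit can be replaced by a bound
valid for all `j`. -/
theorem mem_tauberianSet_iff (hφ : ∀ a, ‖φ a‖ = ‖a‖) {α : ℝ} {z : ℂ} :
    z ∈ tauberianSet (φ q) α ↔ ∃ C : ℝ, 0 ≤ C ∧ ∀ j : ℕ,
      ‖(z • q) * (1 + z • q) ^ j‖ ≤ C / ((j : ℝ) + 1) ^ α := by
  have hn : ∀ j : ℕ, ‖(z • φ q) * (1 + z • φ q) ^ j‖ = ‖(z • q) * (1 + z • q) ^ j‖ := by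
    intro j
    rw [← hφ]
    simp
  have hpos : ∀ j : ℕ, 0 < ((j : ℝ) + 1) ^ α := fun j => Real.rpow_pos_of_pos (by positivity) _
  simp only [tauberianSet, Set.mem_ofPred_eq, hn]
  constructor
  · intro h
    obtain ⟨C, hC⟩ := h.bddAbove_range
    have hC' : ∀ j : ℕ, ((j : ℝ) + 1) ^ α * ‖(z • q) * (1 + z • q) ^ j‖ ≤ C := fun j =>
      hC ⟨j, rfl⟩
    refine ⟨C, ?_, fun j => (le_div_iff₀' (hpos j)).2 (hC' j)⟩
    exact (mul_nonneg (hpos 0).le (norm_nonneg _)).trans (hC' 0)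
  · rintro ⟨C, -, hC⟩
    exact isBoundedUnder_of ⟨C, fun j => (le_div_iff₀' (hpos j)).1 (hC j)⟩

theorem mem_tauberianSet_one_iff (hφ : ∀ a, ‖φ a‖ = ‖a‖) {z : ℂ} :
    z ∈ tauberianSet (φ q) 1 ↔ ∃ C : ℝ, 0 ≤ C ∧ ∀ j : ℕ,
      ‖(z • q) * (1 + z • q) ^ j‖ ≤ C / ((j : ℝ) + 1) := by
  simp only [mem_tauberianSet_iff hφ, Real.rpow_one]

theorem mem_tauberianSet_half_iff (hφ : ∀ a, ‖φ a‖ = ‖a‖) {z : ℂ} :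
    z ∈ tauberianSet (φ q) (1 / 2) ↔ ∃ C : ℝ, 0 ≤ C ∧ ∀ j : ℕ,
      ‖(z • q) * (1 + z • q) ^ j‖ ≤ C / √((j : ℝ) + 1) := by
  simp only [mem_tauberianSet_iff hφ, Real.sqrt_eq_rpow]

end Transfer

/-! ### Inclusions between the sets -/

section Inclusions

variable {X : Type*} [NormedAddCommGroup X] [NormedSpace ℂ X] [CompleteSpace X]
  {A : Type*} [NormedCommRing A] [NormedAlgebra ℂ A] [CompleteSpace A] [NormOneClass A]
  {φ : A →ₐ[ℂ] (X →L[ℂ] X)} {q : A}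

theorem isUnit_one_sub_smul_smul (hq : ∀ w : ℂ, IsUnit (1 - w • q)) (z w : ℂ) :
    IsUnit (1 - w • (z • q)) := by
  rw [smul_smul]
  exact hq _

theorem rittSet_subset_tauberianSet (hφ : ∀ a, ‖φ a‖ = ‖a‖)
    (hq : ∀ w : ℂ, IsUnit (1 - w • q)) : rittSet (φ q) ⊆ tauberianSet (φ q) 1 := by
  intro z hz
  obtain ⟨M, hM⟩ := (mem_rittSet_iff hφ hq).1 hz
  have hM0 : 0 ≤ M := (norm_nonneg _).trans (hM 0 (by norm_num))
  exact (mem_tauberianSet_one_iff hφ).2 ⟨4 * Real.exp 1 * (M + 1) * M ^ 2, by positivity,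
    norm_mul_one_add_pow_le_of_norm_inverse_le (isUnit_one_sub_smul_smul hq z) hM⟩

theorem rittSet_subset_abelSet (hφ : ∀ a, ‖φ a‖ = ‖a‖)
    (hq : ∀ w : ℂ, IsUnit (1 - w • q)) : rittSet (φ q) ⊆ abelSet (φ q) 1 := by
  intro z hz
  obtain ⟨M, hM⟩ := (mem_rittSet_iff hφ hq).1 hz
  refine (mem_abelSet_iff hφ hq).2 ⟨M, 1, one_pos, fun s hs => ?_⟩
  rw [pow_one]
  refine hM s ?_
  rw [Complex.ofReal_re]
  linarith

theorem abelSet_inter_tauberianSet_subset (hφ : ∀ a, ‖φ a‖ = ‖a‖)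
    (hq : ∀ w : ℂ, IsUnit (1 - w • q)) {k : ℕ} (hk : 1 ≤ k) :
    abelSet (φ q) k ∩ tauberianSet (φ q) 1 ⊆ hilleYosidaSet (φ q) := by
  rintro z ⟨hz, hz'⟩
  obtain ⟨M, s₀, hs₀, hM⟩ := (mem_abelSet_iff hφ hq).1 hz
  obtain ⟨C, hC0, hC⟩ := (mem_tauberianSet_one_iff hφ).1 hz'
  have hN := isUnit_one_sub_smul_smul hq z
  obtain ⟨M', hM'⟩ := exists_norm_inverse_le_of_norm_inverse_pow_le hN hk hs₀ hM
  exact (mem_hilleYosidaSet_iff hφ).2 (exists_norm_exp_le_of_norm_inverse_le hN hC0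
    (fun t ht => norm_mul_exp_le_div hC0 hC ht) hs₀ hM')

theorem tauberianSet_one_subset (hφ : ∀ a, ‖φ a‖ = ‖a‖) :
    tauberianSet (φ q) 1 ⊆ tauberianSet (φ q) (1 / 2) := by
  intro z hz
  obtain ⟨C, hC0, hC⟩ := (mem_tauberianSet_one_iff hφ).1 hz
  refine (mem_tauberianSet_half_iff hφ).2 ⟨C, hC0, fun j => (hC j).trans ?_⟩
  have hj : (1 : ℝ) ≤ j + 1 := by linarith [j.cast_nonneg (α := ℝ)]
  have : √((j : ℝ) + 1) ≤ j + 1 := Real.sqrt_le_left (by linarith) |>.2 (by nlinarith)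
  gcongr

theorem hilleYosidaSet_inter_tauberianSet_half_subset (hφ : ∀ a, ‖φ a‖ = ‖a‖) :
    hilleYosidaSet (φ q) ∩ tauberianSet (φ q) (1 / 2) ⊆ powerBoundedSet (φ q) := by
  rintro z ⟨hz, hz'⟩
  obtain ⟨K, hK⟩ := (mem_hilleYosidaSet_iff hφ).1 hz
  obtain ⟨C, hC0, hC⟩ := (mem_tauberianSet_half_iff hφ).1 hz'
  exact (mem_powerBoundedSet_iff hφ).2 (exists_norm_one_add_pow_le_of_norm_exp_le hC0 hC hK)

theorem powerBoundedSet_inter_tauberianSet_subset (hφ : ∀ a, ‖φ a‖ = ‖a‖)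
    (hq : ∀ w : ℂ, IsUnit (1 - w • q)) :
    powerBoundedSet (φ q) ∩ tauberianSet (φ q) 1 ⊆ rittSet (φ q) := by
  rintro z ⟨hz, hz'⟩
  obtain ⟨C, hC⟩ := (mem_powerBoundedSet_iff hφ).1 hz
  obtain ⟨D, hD0, hD⟩ := (mem_tauberianSet_one_iff hφ).1 hz'
  exact (mem_rittSet_iff hφ hq).2 ⟨_, fun s hs => norm_inverse_le_of_norm_mul_one_add_pow_le
    (isUnit_one_sub_smul_smul hq z) hC hD0 hD hs⟩

theorem powerBoundedSet_subset_hilleYosidaSet (hφ : ∀ a, ‖φ a‖ = ‖a‖) :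
    powerBoundedSet (φ q) ⊆ hilleYosidaSet (φ q) := by
  intro z hz
  obtain ⟨C, hC⟩ := (mem_powerBoundedSet_iff hφ).1 hz
  exact (mem_hilleYosidaSet_iff hφ).2 ⟨C, fun t ht => norm_exp_le_of_norm_one_add_pow_le hC ht⟩

theorem hilleYosidaSet_mul_posReals_subset (hφ : ∀ a, ‖φ a‖ = ‖a‖) :
    hilleYosidaSet (φ q) * posReals ⊆ hilleYosidaSet (φ q) := by
  rintro _ ⟨z, hz, _, ⟨r, hr, rfl⟩, rfl⟩
  have hr0 : 0 < r := hr
  obtain ⟨K, hK⟩ := (mem_hilleYosidaSet_iff hφ).1 hz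
  refine (mem_hilleYosidaSet_iff hφ).2 ⟨K, fun t ht => ?_⟩
  have h := hK (t * r) (by positivity)
  rwa [mul_smul, ← Complex.coe_smul r, smul_smul, mul_comm] at h

theorem hilleYosidaSet_mul_rightHalfPlane_subset (hφ : ∀ a, ‖φ a‖ = ‖a‖)
    (hq : ∀ w : ℂ, IsUnit (1 - w • q)) (k : ℕ) :
    hilleYosidaSet (φ q) * rightHalfPlane ⊆ abelSet (φ q) k := by
  rintro _ ⟨z, hz, c, hc, rfl⟩
  have hc0 : 0 < c.re := hc
  obtain ⟨K, hK⟩ := (mem_hilleYosidaSet_iff hφ).1 hz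
  refine (mem_abelSet_iff hφ hq).2 ⟨(K * (‖c‖ / c.re)) ^ k, 1, one_pos, fun s hs => ?_⟩
  have hs0 : 0 < s := by linarith
  refine (norm_pow_le _ _).trans (pow_le_pow_left₀ (norm_nonneg _) ?_ k)
  have h := norm_inverse_le_of_norm_exp_le (isUnit_one_sub_smul_smul hq z) hK
    (w := (s : ℂ) * c) (by simpa using mul_pos hs0 hc0)
  -- The Laplace constant depends only on the direction of `c`, hence is uniform along the ray.
  have hn : ‖(s : ℂ) * c‖ / ((s : ℂ) * c).re = ‖c‖ / c.re := by
    rw [norm_mul, Complex.norm_real, Real.norm_of_nonneg hs0.le, Complex.re_ofReal_mul,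
      mul_div_mul_left _ _ hs0.ne']
  rw [hn, smul_smul, mul_assoc, mul_comm c z, ← smul_smul] at h
  exact h

theorem subset_mul_of_one_mem {S T : Set ℂ} (hT : (1 : ℂ) ∈ T) : S ⊆ S * T := fun z hz =>
  ⟨z, hz, 1, hT, mul_one z⟩

theorem one_mem_posReals : (1 : ℂ) ∈ posReals := ⟨1, Set.mem_Ioi.2 one_pos, Complex.ofReal_one⟩

theorem one_mem_rightHalfPlane : (1 : ℂ) ∈ rightHalfPlane := by simp [rightHalfPlane]

theorem hilleYosidaSet_subset_abelSet (hφ : ∀ a, ‖φ a‖ = ‖a‖)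
    (hq : ∀ w : ℂ, IsUnit (1 - w • q)) (k : ℕ) : hilleYosidaSet (φ q) ⊆ abelSet (φ q) k :=
  (subset_mul_of_one_mem one_mem_rightHalfPlane).trans
    (hilleYosidaSet_mul_rightHalfPlane_subset hφ hq k)

/-- Scaling by `r` turns the half-plane `Re s > -1/2` into `Re s > -r/2`, so the Ritt bound must
first be extended to the left when `r > 1`. -/
theorem rittSet_mul_posReals_subset (hφ : ∀ a, ‖φ a‖ = ‖a‖)
    (hq : ∀ w : ℂ, IsUnit (1 - w • q)) : rittSet (φ q) * posReals ⊆ rittSet (φ q) := by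
  rintro _ ⟨z, hz, _, ⟨r, hr, rfl⟩, rfl⟩
  have hr0 : 0 < r := hr
  obtain ⟨M, hM⟩ := (mem_rittSet_iff hφ hq).1 hz
  obtain ⟨M', hM'⟩ := exists_norm_inverse_le_of_neg_lt_re (isUnit_one_sub_smul_smul hq z) hM
    (half_pos hr0)
  refine (mem_rittSet_iff hφ hq).2 ⟨M', fun s hs => ?_⟩
  have h := hM' (s * r) (by
    rw [mul_comm, Complex.re_ofReal_mul]
    nlinarith)
  rwa [smul_smul, mul_assoc, mul_comm (r : ℂ) z, ← smul_smul] at h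

theorem powerBoundedSet_mul_unitIco_subset (hφ : ∀ a, ‖φ a‖ = ‖a‖) :
    powerBoundedSet (φ q) * unitIco ⊆ tauberianSet (φ q) (1 / 2) := by
  rintro _ ⟨z, hz, _, ⟨p, ⟨hp0, hp1⟩, rfl⟩, rfl⟩
  obtain ⟨C, hC⟩ := (mem_powerBoundedSet_iff hφ).1 hz
  have hC0 : 0 ≤ C := (norm_nonneg _).trans (hC 0)
  refine (mem_tauberianSet_half_iff hφ).2 ?_
  -- The constant `C / √(p (1 - p))` degenerates at `p = 0`, where the operator vanishes anyway.
  rcases hp0.eq_or_lt with rfl | hp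
  · exact ⟨0, le_rfl, fun j => by simp⟩
  refine ⟨p * (C / √(p * (1 - p))), by positivity, fun j => ?_⟩
  have h := norm_mul_one_add_smul_pow_le hC hp hp1 j
  have hz' : (z * (p : ℂ)) • q = p • (z • q) := by
    rw [← Complex.coe_smul, smul_smul, mul_comm]
  change ‖((z * (p : ℂ)) • q) * (1 + (z * (p : ℂ)) • q) ^ j‖ ≤ _
  rw [hz', smul_mul_assoc, norm_smul, Real.norm_of_nonneg hp.le, mul_div_assoc]
  gcongr

theorem powerBoundedSet_subset_iteratedKreissSet (hφ : ∀ a, ‖φ a‖ = ‖a‖)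
    (hq : ∀ w : ℂ, IsUnit (1 - w • q)) : powerBoundedSet (φ q) ⊆ iteratedKreissSet (φ q) := by
  intro z hz
  obtain ⟨C, hC⟩ := (mem_powerBoundedSet_iff hφ).1 hz
  exact (mem_iteratedKreissSet_iff hφ hq).2 ⟨C, fun s hs k _ =>
    mul_norm_inverse_pow_le (isUnit_one_sub_smul_smul hq z) hC hs k⟩

theorem iteratedKreissSet_subset_kreissSet (Q : X →L[ℂ] X) :
    iteratedKreissSet Q ⊆ kreissSet Q := fun _ ⟨M, hM⟩ =>
  ⟨M, fun s hs => by simpa using hM s hs 1 le_rfl⟩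

theorem iteratedKreissSet_subset_hilleYosidaSet (hφ : ∀ a, ‖φ a‖ = ‖a‖)
    (hq : ∀ w : ℂ, IsUnit (1 - w • q)) : iteratedKreissSet (φ q) ⊆ hilleYosidaSet (φ q) := by
  intro z hz
  obtain ⟨M, hM⟩ := (mem_iteratedKreissSet_iff hφ hq).1 hz
  have hM' : ∀ s : ℝ, 0 < s → ∀ k : ℕ, 1 ≤ k →
      ‖Ring.inverse (1 - (s : ℂ) • (z • q)) ^ k‖ ≤ M := by
    intro s hs k hk
    have h := hM s (by rw [Complex.ofReal_re]; linarith) k hk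
    -- On the positive axis the Kreiss weight is exactly `1`, so its powers disappear.
    have hn : ‖(s : ℂ) + 1‖ - ‖(s : ℂ)‖ = 1 := by
      rw [← Complex.ofReal_one, ← Complex.ofReal_add, Complex.norm_real, Complex.norm_real,
        Real.norm_of_nonneg (by linarith), Real.norm_of_nonneg hs.le]
      ring
    rwa [hn, one_pow, one_mul] at h
  refine (mem_hilleYosidaSet_iff hφ).2 ⟨max M 1, fun t ht => ?_⟩
  rcases ht.eq_or_lt with rfl | ht0
  · rw [zero_smul, exp_zero, norm_one]
    exact le_max_right _ _
  · exact (norm_exp_le_of_norm_inverse_pow_le (isUnit_one_sub_smul_smul hq z) hM' ht0).trans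
      (le_max_left _ _)

theorem kreissSet_mul_rightHalfPlane_subset (hφ : ∀ a, ‖φ a‖ = ‖a‖)
    (hq : ∀ w : ℂ, IsUnit (1 - w • q)) : kreissSet (φ q) * rightHalfPlane ⊆ abelSet (φ q) 1 := by
  rintro _ ⟨z, hz, c, hc, rfl⟩
  obtain ⟨M, hM⟩ := (mem_kreissSet_iff hφ hq).1 hz
  refine (mem_abelSet_iff hφ hq).2 ⟨M / (2 * c.re / (2 * ‖c‖ + 1)), 1, one_pos, fun s hs => ?_⟩
  have h := norm_le_of_mul_norm_le (F := fun s => Ring.inverse (1 - s • (z • q))) hM hc hs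
  beta_reduce at h
  rw [smul_smul, mul_assoc, mul_comm c z, ← smul_smul] at h
  rwa [pow_one]

theorem sqrtSet_inter_hilleYosidaSet_subset (hφ : ∀ a, ‖φ a‖ = ‖a‖)
    (hq : ∀ w : ℂ, IsUnit (1 - w • q)) :
    sqrtSet (-powerBoundedSet (φ q ^ 2)) ∩ hilleYosidaSet (φ q) ⊆ powerBoundedSet (φ q) := by
  rintro z ⟨hz, hz'⟩
  have hz2 : -z ^ 2 ∈ powerBoundedSet (φ (q ^ 2)) := by
    rw [map_pow]
    exact hz
  obtain ⟨D, hD⟩ := (mem_powerBoundedSet_iff hφ).1 hz2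
  obtain ⟨K, hK⟩ := (mem_hilleYosidaSet_iff hφ).1 hz'
  refine (mem_powerBoundedSet_iff hφ).2 ⟨D * K, fun j => ?_⟩
  refine norm_one_add_pow_le_of_norm_one_sub_sq_pow_le (isUnit_one_sub_smul_smul hq z) hK ?_
  have h := hD j
  rwa [neg_smul, ← sub_eq_add_neg, ← smul_pow] at h

end Inclusions

end Microspectral

/-! ### Assembly -/

open Microspectral in
theorem theorem2p7 {X : Type*} [NormedAddCommGroup X] [NormedSpace ℂ X] [CompleteSpace X]
    (Q : X →L[ℂ] X) (hQ : spectrum ℂ Q = {0}) :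
    (rittSet Q = powerBoundedSet Q ∩ tauberianSet Q 1) ∧
    ((∀ k : ℕ, 1 ≤ k → hilleYosidaSet Q * rightHalfPlane ⊆ abelSet Q k) ∧
      rittSet Q * rightHalfPlane ⊆ abelSet Q 1) ∧
    (powerBoundedSet Q ⊆ powerBoundedSet Q * posReals ∧
      powerBoundedSet Q * posReals ⊆ hilleYosidaSet Q ∧
      ∀ k : ℕ, 1 ≤ k → hilleYosidaSet Q ⊆ abelSet Q k) ∧
    (∀ k : ℕ, 1 ≤ k → rittSet Q = abelSet Q k ∩ tauberianSet Q 1) ∧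
    (tauberianSet Q 1 ⊆ tauberianSet Q (1 / 2) ∧
      hilleYosidaSet Q ∩ tauberianSet Q (1 / 2) ⊆ powerBoundedSet Q) ∧
    (rittSet Q = hilleYosidaSet Q ∩ tauberianSet Q 1) ∧
    (rittSet Q * posReals = rittSet Q) ∧
    (powerBoundedSet Q * unitIco ⊆ tauberianSet Q (1 / 2)) ∧
    (powerBoundedSet Q ⊆ kreissSet Q ∧ kreissSet Q * rightHalfPlane ⊆ abelSet Q 1) ∧
    (powerBoundedSet Q ⊆ iteratedKreissSet Q ∧
      iteratedKreissSet Q ⊆ hilleYosidaSet Q ∩ kreissSet Q) ∧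
    (sqrtSet (-powerBoundedSet (Q ^ 2)) ∩ hilleYosidaSet Q ⊆ powerBoundedSet Q) := by
  -- A nonempty spectrum excludes `X = 0`; this gives the operator algebra a unit of norm one.
  have hX : Nontrivial X := by
    by_contra h
    have := not_nontrivial_iff_subsingleton.1 h
    rw [spectrum.of_subsingleton] at hQ
    exact (Set.singleton_nonempty (0 : ℂ)).ne_empty hQ.symm
  have hunit := isUnit_one_sub_smul_of_spectrum_eq hQ
  clear hQ
  obtain ⟨A, _, _, _, _, φ, q, hφ, rfl, hinv⟩ := exists_commutative_banach_algebra Q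
  have hq : ∀ w : ℂ, IsUnit (1 - w • q) := fun w => hinv _ (by simpa using hunit w)
  have hRT := rittSet_subset_tauberianSet hφ hq
  -- The cycle starts here: Ritt gives Abel and the decay, hence a bounded exponential, then bounded
  -- powers, then Ritt again.
  have hRG : rittSet (φ q) ⊆ hilleYosidaSet (φ q) := fun z hz =>
    abelSet_inter_tauberianSet_subset hφ hq le_rfl ⟨rittSet_subset_abelSet hφ hq hz, hRT hz⟩
  have hTT := tauberianSet_one_subset (q := q) hφ
  have hGT := hilleYosidaSet_inter_tauberianSet_half_subset (q := q) hφ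
  have hBT := powerBoundedSet_inter_tauberianSet_subset hφ hq
  have hRB : rittSet (φ q) ⊆ powerBoundedSet (φ q) := fun z hz => hGT ⟨hRG hz, hTT (hRT hz)⟩
  have hGTR : hilleYosidaSet (φ q) ∩ tauberianSet (φ q) 1 ⊆ rittSet (φ q) := fun z hz =>
    hBT ⟨hGT ⟨hz.1, hTT hz.2⟩, hz.2⟩
  have hBG := powerBoundedSet_subset_hilleYosidaSet (q := q) hφ
  have hBK := powerBoundedSet_subset_iteratedKreissSet hφ hq
  refine ⟨?_, ⟨fun k _ => hilleYosidaSet_mul_rightHalfPlane_subset hφ hq k, ?_⟩,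
    ⟨subset_mul_of_one_mem one_mem_posReals, ?_, fun k _ => hilleYosidaSet_subset_abelSet hφ hq k⟩,
    fun k hk => ?_, ⟨hTT, hGT⟩, ?_, ?_, powerBoundedSet_mul_unitIco_subset hφ,
    ⟨hBK.trans (iteratedKreissSet_subset_kreissSet _), kreissSet_mul_rightHalfPlane_subset hφ hq⟩,
    ⟨hBK, Set.subset_inter (iteratedKreissSet_subset_hilleYosidaSet hφ hq)
      (iteratedKreissSet_subset_kreissSet _)⟩, sqrtSet_inter_hilleYosidaSet_subset hφ hq⟩
  · exact (Set.subset_inter hRB hRT).antisymm hBT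
  · exact (Set.mul_subset_mul_right hRG).trans (hilleYosidaSet_mul_rightHalfPlane_subset hφ hq 1)
  · exact (Set.mul_subset_mul_right hBG).trans (hilleYosidaSet_mul_posReals_subset hφ)
  · exact (Set.subset_inter (hRG.trans (hilleYosidaSet_subset_abelSet hφ hq k)) hRT).antisymm
      fun z hz => hGTR ⟨abelSet_inter_tauberianSet_subset hφ hq hk hz, hz.2⟩
  · exact (Set.subset_inter hRG hRT).antisymm hGTR
  · exact (rittSet_mul_posReals_subset hφ hq).antisymm (subset_mul_of_one_mem one_mem_posReals)
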